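/- **Setting.** Let $M$ be a smooth manifold (finite-dimensional, Hausdorff, second countable, without boundary) and $\tau:E\to M$ a smooth real vector bundle of finite rank with a Lie algebroid structure: an anchor $\rho:E\to TM$ (a smooth vector bundle map over $\mathrm{id}_M$) and a real Lie algebra bracket $[\cdot,\cdot]$ on $\mathrm{Sec}(E)$ with $[\sigma,f\eta]=f[\sigma,\eta]+(\rho(\sigma)f)\,\eta$ for $f\in C^\infty(M)$. For $a\in E$ put $$\mathcal T_aE=\{(b,v)\in E_{\tau(a)}\times T_aE:\ \rho(b)=T_a\tau(v)\},$$ and for a function $f$ on $E$ write $d_{(b,v)}f=\langle df,(b,v)\rangle=v(f)$. A section $Z$ of $\mathcal TE\to E$ is *projectable* if $Z(a)=(\sigma(\tau(a)),X(a))$ with $\sigma\in\mathrm{Sec}(E)$ and $X$ a vector field on $E$; brackets of projectable sections are $[(\sigma,X),(\eta,Y)]=([\sigma,\eta],[X,Y])$. For a $1$-form $\theta$ on $\mathcal TE$, $d\theta$ is the $2$-form with $d\theta(Z,W)=d_Z(\theta(W))-d_W(\theta(Z))-\theta([Z,W])$ for projectable $Z,W$. For $a\in E$ and $b\in E_{\tau(a)}$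 let $b^V_a=\frac{d}{dt}\big|_{t=0}(a+tb)\in T_aE$. The vertical endomorphism is $S(b,v)=(0,b^V_a)$ on $\mathcal T_aE$, and the Liouville section is $\Delta(a)=(0,a^V_a)$. A section $\Gamma$ is a SODE if $S\Gamma=\Delta$. For $L\in C^\infty(E)$ put $\theta_L=dL\circ S$, $\omega_L=-d\theta_L$ and $E_L=d_\Delta L-L$. For $\sigma\in\mathrm{Sec}(E)$, the *complete lift* $\sigma^C$ is the section of $\mathcal TE$ such that $\sigma^C(a)$ has first component $\sigma(\tau(a))$ and $d_{\sigma^C}\hat\mu=\widehat{d_\sigma\mu}$ for all $\mu\in\mathrm{Sec}(E^*)$. Here $\hat\mu(a)=\langle\mu_{\tau(a)},a\rangle$ and $\langle d_\sigma\mu,\eta\rangle=\rho(\sigma)\langle\mu,\eta\rangle-\langle\mu,[\sigma,\eta]\rangle$. For $f\in C^\infty(M)$ put $\dot f(a)=\rho(a)f$. A *constrained Lagrangian system* $(L,D)$ consists of $L\in C^\infty(E)$ and a smooth vector subbundle $D\subseteq E$ over $M$. A *SODE solution of its dynamics* is a smooth section $\Gamma$ of $\mathcal TE$ along $D$ such that,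 for every $a\in D$, 1. $S\Gamma(a)=\Delta(a)$; 2. $\Gamma(a)=(b,v)$ with $b\in D_{\tau(a)}$ and $v\in T_aD$; 3. (Lagrange–d'Alembert equations) there is $\lambda\in E_{\tau(a)}^*$ vanishing on $D_{\tau(a)}$ such that $\omega_L(\Gamma(a),z)-d_zE_L=\langle\lambda,b'\rangle$ for all $z=(b',v')\in\mathcal T_aE$. **Theorem (Noether's theorem).** Let $(L,D)$ be a constrained Lagrangian system on $E$ that admits a unique SODE solution $\Gamma$ of its dynamics (unique as a section along $D$). Let $\sigma\in\mathrm{Sec}(E)$ be a section of $D$ for which there is $f\in C^\infty(M)$ with $d_{\sigma^C}L=\dot f$ at all points of $D$. Then $$F=\langle\theta_L,\sigma^C\rangle-f\circ\tau$$ is a smooth function on $E$ and is a constant of the motion on $D$: $$d_{\Gamma(a)}F=0\qquad\text{for all } a\in D.$$ -/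

import Mathlib

open Bundle Set Filter Topology
open scoped Manifold ContDiff

noncomputable section

namespace AlgebroidMechanics

set_option linter.unusedSectionVars false

section Algebroid

variable {V : Type*} [NormedAddCommGroup V] [NormedSpace ℝ V]
  {H : Type*} [TopologicalSpace H] (I : ModelWithCorners ℝ V H)
  {M : Type*} [TopologicalSpace M] [ChartedSpace H M] [IsManifold I ∞ M]
  (F : Type*) [NormedAddCommGroup F] [NormedSpace ℝ F]
  (E : M → Type*) [TopologicalSpace (TotalSpace F E)]
  [∀ x, AddCommGroup (E x)] [∀ x, Module ℝ (E x)] [∀ x, TopologicalSpace (E x)]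
  [FiberBundle F E] [VectorBundle ℝ F E]

variable {I F E} in
/-- The product of a smooth function and a smooth section. -/
def funSMul (f : C^∞⟮I, M; ℝ⟯) (σ : Cₛ^∞⟮I; F, E⟯) : Cₛ^∞⟮I; F, E⟯ :=
  ⟨fun x => f x • σ x, f.contMDiff.smul_section σ.contMDiff⟩

/-- A Lie algebroid structure on the smooth vector bundle `E → M`: a smooth vector bundle map
`E → TM` over the identity (the anchor) and a Lie bracket on the smooth sections of `E`,
related by `[σ, fη] = f[σ, η] + (ρ(σ)f) η`. -/
structure LieAlgebroid where
  anchor : ∀ x : M, E x →ₗ[ℝ] TangentSpace I x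
  contMDiff_anchor : ContMDiff (I.prod 𝓘(ℝ, F)) I.tangent ∞
    (fun a : TotalSpace F E => (⟨a.proj, anchor a.proj a.snd⟩ : TangentBundle I M))
  bracket : Cₛ^∞⟮I; F, E⟯ →ₗ[ℝ] Cₛ^∞⟮I; F, E⟯ →ₗ[ℝ] Cₛ^∞⟮I; F, E⟯
  bracket_self : ∀ σ, bracket σ σ = 0
  jacobi : ∀ σ η ζ,
    bracket σ (bracket η ζ) = bracket (bracket σ η) ζ + bracket η (bracket σ ζ)
  leibniz : ∀ (σ η : Cₛ^∞⟮I; F, E⟯) (f : C^∞⟮I, M; ℝ⟯) (x : M),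
    bracket σ (funSMul f η) x =
      f x • bracket σ η x + (mvfderiv I f x (anchor x (σ x))) • η x

end Algebroid
section TB
variable {V : Type*} [NormedAddCommGroup V] [NormedSpace ℝ V] [FiniteDimensional ℝ V]
  {H : Type*} [TopologicalSpace H] (I : ModelWithCorners ℝ V H)
  {M : Type*} [TopologicalSpace M] [ChartedSpace H M] [IsManifold I ∞ M]

/-- The tangent bundle with the identity as anchor and the Lie bracket of vector fields. -/
def tangentLieAlgebroid : LieAlgebroid I V (TangentSpace I : M → Type _) where
  anchor x := LinearMap.id
  contMDiff_anchor := contMDiff_id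
  bracket := LinearMap.mk₂ ℝ
    (fun X Y => ⟨fun x => VectorField.mlieBracket I X Y x, by
      have : IsManifold I (((⊤ : ℕ∞) : WithTop ℕ∞) + 1) M := ‹IsManifold I ∞ M›
      have : IsManifold I (minSmoothness ℝ 2) M := by
        rw [minSmoothness_of_isRCLikeNormedField]
        infer_instance
      exact ContDiff.mlieBracket_vectorField (n := ⊤) (m := ⊤) X.contMDiff Y.contMDiff (by simp)⟩)
    (by
      intro X X' Y; ext x
      exact VectorField.mlieBracket_add_left X.mdifferentiableAt X'.mdifferentiableAt)
    (by
      intro c X Y; ext x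
      exact VectorField.mlieBracket_const_smul_left X.mdifferentiableAt)
    (by
      intro X Y Y'; ext x
      exact VectorField.mlieBracket_add_right Y.mdifferentiableAt Y'.mdifferentiableAt)
    (by
      intro c X Y; ext x
      exact VectorField.mlieBracket_const_smul_right Y.mdifferentiableAt)
  bracket_self X := by ext x; simp
  jacobi X Y Z := by
    ext x
    have : IsManifold I (minSmoothness ℝ 3) M := by
      rw [minSmoothness_of_isRCLikeNormedField]
      infer_instance
    have h : (minSmoothness ℝ 2) ≤ ∞ := by
      rw [minSmoothness_of_isRCLikeNormedField]
      exact ENat.LEInfty.out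
    exact VectorField.leibniz_identity_mlieBracket_apply (X.contMDiff.contMDiffAt.of_le h)
      (Y.contMDiff.contMDiffAt.of_le h) (Z.contMDiff.contMDiffAt.of_le h)
  leibniz X Y f x := by
    have := VectorField.mlieBracket_smul_right (I := I) (V := X) (W := Y) (f := f) (x := x)
      (f.contMDiff.mdifferentiableAt (by simp)) Y.mdifferentiableAt
    exact this.trans (add_comm _ _)

end TB

section Bump
variable {V : Type*} [NormedAddCommGroup V] [NormedSpace ℝ V] [FiniteDimensional ℝ V]
  {H : Type*} [TopologicalSpace H] (I : ModelWithCorners ℝ V H)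
  {M : Type*} [TopologicalSpace M] [ChartedSpace H M] [IsManifold I ∞ M] [T2Space M]
  (F : Type*) [NormedAddCommGroup F] [NormedSpace ℝ F]
  {E : M → Type*} [TopologicalSpace (TotalSpace F E)]
  [∀ x, AddCommGroup (E x)] [∀ x, Module ℝ (E x)] [∀ x, TopologicalSpace (E x)]
  [FiberBundle F E] [VectorBundle ℝ F E]

lemma exists_bump {x : M} {U : Set M} (hU : U ∈ 𝓝 x) :
    ∃ χ : C^∞⟮I, M; ℝ⟯, tsupport χ ⊆ U ∧ ∀ᶠ y in 𝓝 x, χ y = 1 := by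
  obtain ⟨φ, -, hφ⟩ := (SmoothBumpFunction.nhds_basis_tsupport (I := I) x).mem_iff.1 hU
  exact ⟨⟨φ, φ.contMDiff⟩, hφ, φ.eventuallyEq_one⟩

variable {F} in
lemma exists_section_eventuallyEq {x : M} {U : Set M} (hU : IsOpen U) (hx : x ∈ U)
    (s : ∀ x, E x) (hs : ContMDiffOn I (I.prod 𝓘(ℝ, F)) ∞ (fun y => TotalSpace.mk' F y (s y)) U) :
    ∃ σ : Cₛ^∞⟮I; F, E⟯, ∀ᶠ y in 𝓝 x, σ y = s y := by
  obtain ⟨χ, h1, h2⟩ := exists_bump I (hU.mem_nhds hx)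
  refine ⟨⟨fun y => χ y • s y,
    ContMDiffOn.smul_section_of_tsupport χ.contMDiff.contMDiffOn hU h1 hs⟩, ?_⟩
  filter_upwards [h2] with y hy
  change χ y • s y = s y
  rw [hy, one_smul]

variable [ContMDiffVectorBundle ∞ F E I]

lemma contMDiffOn_symm_const (e : Trivialization F (π F E)) [MemTrivializationAtlas e]
    (w : M → F) (hw : ContMDiffOn I 𝓘(ℝ, F) ∞ w e.baseSet) :
    ContMDiffOn I (I.prod 𝓘(ℝ, F)) ∞ (fun y => TotalSpace.mk' F y (e.symm y (w y))) e.baseSet := by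
  rw [e.contMDiffOn_section_baseSet_iff]
  refine hw.congr fun y hy => ?_
  rw [e.apply_mk_symm hy]

/-- Every vector of a smooth vector bundle is the value of a smooth global section. -/
lemma exists_section_through (x : M) (b : E x) : ∃ σ : Cₛ^∞⟮I; F, E⟯, σ x = b := by
  set e := trivializationAt F E x
  have hx : x ∈ e.baseSet := FiberBundle.mem_baseSet_trivializationAt' x
  obtain ⟨σ, hσ⟩ := exists_section_eventuallyEq I e.open_baseSet hx _
    (contMDiffOn_symm_const I F e (fun _ => (e ⟨x, b⟩).2) contMDiffOn_const)
  refine ⟨σ, ?_⟩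
  rw [hσ.self_of_nhds, e.symm_apply_apply_mk hx]

/-- Smooth functions separate tangent vectors. -/
lemma tangent_ext [I.Boundaryless] {x : M} {v w : TangentSpace I x}
    (h : ∀ f : C^∞⟮I, M; ℝ⟯, mvfderiv I f x v = mvfderiv I f x w) : v = w := by
  obtain ⟨χ, h1, h2⟩ := exists_bump I (extChartAt_source_mem_nhds (I := I) x)
  have key : ∀ l : V →L[ℝ] ℝ, l v = l w := by
    intro l
    have hs : ContMDiff I 𝓘(ℝ, ℝ) ∞ (fun y => χ y * l (extChartAt I x y)) := by
      have := contMDiff_of_tsupport (f := fun y => χ y * l (extChartAt I x y)) (I := I) (I' := 𝓘(ℝ, ℝ)) (n := ∞) (M := M)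
      apply this
      intro y hy
      have hy' : y ∈ (extChartAt I x).source := h1 (closure_mono (fun z hz => by
        simp only [Function.mem_support, ne_eq] at hz ⊢
        intro h0; exact hz (by rw [h0, zero_mul])) hy)
      have e1 : ContMDiffAt I 𝓘(ℝ, V) ∞ (extChartAt I x) y :=
        contMDiffAt_extChartAt' (by simpa using hy')
      exact (χ.contMDiff.contMDiffAt).mul (l.contMDiff.contMDiffAt.comp y e1)
    have := h ⟨_, hs⟩
    have e2 : (fun y => χ y * l (extChartAt I x y)) =ᶠ[𝓝 x] fun y => l (extChartAt I x y) := by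
      filter_upwards [h2] with y hy
      rw [hy, one_mul]
    have e3 : mfderiv I 𝓘(ℝ, ℝ) (fun y => χ y * l (extChartAt I x y)) x
        = l := by
      rw [e2.mfderiv_eq]
      have := mfderiv_comp (I := I) (I' := 𝓘(ℝ, V)) (I'' := 𝓘(ℝ, ℝ)) x (g := l) (f := extChartAt I x) l.mdifferentiableAt
        (mdifferentiableAt_extChartAt (mem_chart_source _ _))
      erw [this, mfderiv_extChartAt_self]
      simp
      rfl
    change mfderiv I 𝓘(ℝ, ℝ) (fun y => χ y * l (extChartAt I x y)) x v = mfderiv I 𝓘(ℝ, ℝ) (fun y => χ y * l (extChartAt I x y)) x w at this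
    rw [e3] at this
    exact this
  have : (v : V) = w := by
    by_contra hne
    obtain ⟨l, hl⟩ := SeparatingDual.exists_separating_of_ne (R := ℝ) (V := V) hne
    exact hl (key l)
  exact this
end Bump

section Anchor
variable {V : Type*} [NormedAddCommGroup V] [NormedSpace ℝ V] [FiniteDimensional ℝ V]
  {H : Type*} [TopologicalSpace H] {I : ModelWithCorners ℝ V H}
  {M : Type*} [TopologicalSpace M] [ChartedSpace H M] [IsManifold I ∞ M] [T2Space M]
  {F : Type*} [NormedAddCommGroup F] [NormedSpace ℝ F]
  {E : M → Type*} [TopologicalSpace (TotalSpace F E)]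
  [∀ x, AddCommGroup (E x)] [∀ x, Module ℝ (E x)] [∀ x, TopologicalSpace (E x)]
  [FiberBundle F E] [VectorBundle ℝ F E] [ContMDiffVectorBundle ∞ F E I]

/-- The derivative `X f` of a smooth function along a smooth vector field. -/
def fieldDeriv (X : Cₛ^∞⟮I; V, (TangentSpace I : M → Type _)⟯) (f : C^∞⟮I, M; ℝ⟯) :
    C^∞⟮I, M; ℝ⟯ :=
  ⟨fun x => mvfderiv I f x (X x), by
    have h1 : ContMDiff I.tangent 𝓘(ℝ, ℝ).tangent ∞ (tangentMap I 𝓘(ℝ, ℝ) f) :=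
      f.contMDiff.contMDiff_tangentMap (by simp)
    exact (contMDiff_snd_tangentBundle_modelSpace ℝ 𝓘(ℝ, ℝ)).comp (h1.comp X.contMDiff)⟩

lemma funSMul_apply (f : C^∞⟮I, M; ℝ⟯) (σ : Cₛ^∞⟮I; F, E⟯) (x : M) :
    funSMul f σ x = f x • σ x := rfl

namespace LieAlgebroid
variable (A : LieAlgebroid I F E)

/-- The vector field `ρ(σ)` of a section `σ`. -/
def anchorField (σ : Cₛ^∞⟮I; F, E⟯) : Cₛ^∞⟮I; V, (TangentSpace I : M → Type _)⟯ :=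
  ⟨fun x => A.anchor x (σ x), A.contMDiff_anchor.comp σ.contMDiff⟩

/-- The function `ρ(σ)f`. -/
def sectionDeriv (σ : Cₛ^∞⟮I; F, E⟯) (f : C^∞⟮I, M; ℝ⟯) : C^∞⟮I, M; ℝ⟯ :=
  fieldDeriv (A.anchorField σ) f

lemma sectionDeriv_apply (σ : Cₛ^∞⟮I; F, E⟯) (f : C^∞⟮I, M; ℝ⟯) (x : M) :
    A.sectionDeriv σ f x = mvfderiv I f x (A.anchor x (σ x)) := rfl

lemma bracket_funSMul (σ η : Cₛ^∞⟮I; F, E⟯) (f : C^∞⟮I, M; ℝ⟯) :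
    A.bracket σ (funSMul f η) = funSMul f (A.bracket σ η) + funSMul (A.sectionDeriv σ f) η := by
  ext x
  exact A.leibniz σ η f x

/-- The anchor is a homomorphism of Lie algebras. -/
lemma mvfderiv_anchor_bracket (σ η : Cₛ^∞⟮I; F, E⟯) (f : C^∞⟮I, M; ℝ⟯) (x : M) :
    mvfderiv I f x (A.anchor x (A.bracket σ η x)) =
      mvfderiv I (A.sectionDeriv η f) x (A.anchor x (σ x)) -
        mvfderiv I (A.sectionDeriv σ f) x (A.anchor x (η x)) := by
  rcases subsingleton_or_nontrivial (E x) with hE | hE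
  · rw [Subsingleton.elim (A.bracket σ η x) 0, Subsingleton.elim (σ x) 0,
      Subsingleton.elim (η x) 0]
    simp
  obtain ⟨b, hb⟩ := exists_ne (0 : E x)
  obtain ⟨ζ, rfl⟩ := exists_section_through I F x b
  have h := A.jacobi σ η (funSMul f ζ)
  have h2 := A.jacobi σ η ζ
  simp only [bracket_funSMul, map_add] at h
  have h3 := congrArg (fun s : Cₛ^∞⟮I; F, E⟯ => s x) h
  have h4 := congrArg (fun s : Cₛ^∞⟮I; F, E⟯ => s x) h2
  simp only [ContMDiffSection.coe_add, Pi.add_apply, funSMul_apply, sectionDeriv_apply] at h3 h4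
  rw [← sub_eq_zero]
  have : ∀ c : ℝ, c • ζ x = 0 → c = 0 := fun c hc => (smul_eq_zero.1 hc).resolve_right hb
  apply this
  rw [h4] at h3
  rw [← sub_eq_zero] at h3
  rw [← neg_eq_zero, ← h3]
  module

lemma mvfderiv_mlieBracket [I.Boundaryless] (X Y : Cₛ^∞⟮I; V, (TangentSpace I : M → Type _)⟯) (f : C^∞⟮I, M; ℝ⟯)
    (x : M) : mvfderiv I f x (VectorField.mlieBracket I X Y x) =
      mvfderiv I (fieldDeriv Y f) x (X x) - mvfderiv I (fieldDeriv X f) x (Y x) :=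
  (tangentLieAlgebroid I).mvfderiv_anchor_bracket X Y f x

end LieAlgebroid
end Anchor

section Prolongation

variable {V : Type*} [NormedAddCommGroup V] [NormedSpace ℝ V] [FiniteDimensional ℝ V]
  {H : Type*} [TopologicalSpace H] {I : ModelWithCorners ℝ V H} [I.Boundaryless]
  {M : Type*} [TopologicalSpace M] [ChartedSpace H M] [IsManifold I ∞ M] [T2Space M]
  {F : Type*} [NormedAddCommGroup F] [NormedSpace ℝ F] [FiniteDimensional ℝ F]
  {E : M → Type*} [TopologicalSpace (TotalSpace F E)]
  [∀ x, AddCommGroup (E x)] [∀ x, Module ℝ (E x)] [∀ x, TopologicalSpace (E x)]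
  [FiberBundle F E] [VectorBundle ℝ F E] [ContMDiffVectorBundle ∞ F E I]

variable (I) in
/-- The vertical lift `b_a^V` of `b ∈ E_m` at `a ∈ E_m`: the velocity at `t = 0` of the curve
`t ↦ a + t b`. -/
def verticalVector (a : TotalSpace F E) (b : E a.proj) : TangentSpace (I.prod 𝓘(ℝ, F)) a :=
  mfderiv 𝓘(ℝ, ℝ) (I.prod 𝓘(ℝ, F))
    (fun t : ℝ => (⟨a.proj, a.snd + t • b⟩ : TotalSpace F E)) 0 (1 : ℝ)

variable (I F E) in
lemma t2Space_totalSpace : T2Space (TotalSpace F E) := by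
  refine ⟨fun p q hpq => ?_⟩
  have hc : Continuous (π F E) := FiberBundle.continuous_proj F E
  by_cases h : p.proj = q.proj
  · set e := trivializationAt F E p.proj
    have hp : p ∈ e.source := e.mem_source.2 (FiberBundle.mem_baseSet_trivializationAt' _)
    have hq : q ∈ e.source := e.mem_source.2 (h ▸ FiberBundle.mem_baseSet_trivializationAt' _)
    have hne : e p ≠ e q := fun h' => hpq (e.injOn hp hq h')
    obtain ⟨u, v, hu, hv, hpu, hqv, huv⟩ := t2_separation hne
    refine ⟨e.source ∩ e ⁻¹' u, e.source ∩ e ⁻¹' v, e.continuousOn.isOpen_inter_preimage e.open_source hu,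
      e.continuousOn.isOpen_inter_preimage e.open_source hv, ⟨hp, hpu⟩, ⟨hq, hqv⟩, ?_⟩
    exact ((huv.preimage e).mono inter_subset_right inter_subset_right)
  · obtain ⟨u, v, hu, hv, hpu, hqv, huv⟩ := t2_separation h
    exact ⟨_, _, hu.preimage hc, hv.preimage hc, hpu, hqv, huv.preimage _⟩

variable (I F) in
lemma contMDiff_fiber (m : M) :
    ContMDiff 𝓘(ℝ, F) (I.prod 𝓘(ℝ, F)) ∞
      (fun w : F => (⟨m, (trivializationAt F E m).symm m w⟩ : TotalSpace F E)) := by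
  set e := trivializationAt F E m
  have hm : m ∈ e.baseSet := FiberBundle.mem_baseSet_trivializationAt' m
  intro w
  rw [contMDiffAt_totalSpace]
  refine ⟨contMDiffAt_const, ?_⟩
  refine contMDiffAt_id.congr_of_eventuallyEq (Eventually.of_forall fun y => ?_)
  change (e ⟨m, e.symm m y⟩).2 = y
  rw [e.apply_mk_symm hm]

lemma curve_eq (a : TotalSpace F E) (b : E a.proj) :
    (fun t : ℝ => (⟨a.proj, a.snd + t • b⟩ : TotalSpace F E)) =
      (fun w : F => (⟨a.proj, (trivializationAt F E a.proj).symm a.proj w⟩ : TotalSpace F E)) ∘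
        (fun t : ℝ => (trivializationAt F E a.proj a).2 + t • (trivializationAt F E a.proj ⟨a.proj, b⟩).2) := by
  set e := trivializationAt F E a.proj
  have hm : a.proj ∈ e.baseSet := FiberBundle.mem_baseSet_trivializationAt' a.proj
  funext t
  simp only [Function.comp]
  congr 1
  have h1 : (e a).2 + t • (e ⟨a.proj, b⟩).2 = (e ⟨a.proj, a.snd + t • b⟩).2 := by
    have := (e.linear ℝ hm)
    rw [this.map_add, this.map_smul]
  rw [h1, e.symm_apply_apply_mk hm]

variable (I) in
lemma contMDiff_curve (a : TotalSpace F E) (b : E a.proj) :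
    ContMDiff 𝓘(ℝ, ℝ) (I.prod 𝓘(ℝ, F)) ∞
      (fun t : ℝ => (⟨a.proj, a.snd + t • b⟩ : TotalSpace F E)) := by
  rw [curve_eq]
  refine (contMDiff_fiber I F a.proj).comp ?_
  rw [contMDiff_iff_contDiff]
  fun_prop

lemma mfderiv_congr_point {V₁ : Type*} [NormedAddCommGroup V₁] [NormedSpace ℝ V₁]
    {H₁ : Type*} [TopologicalSpace H₁] {I₁ : ModelWithCorners ℝ V₁ H₁}
    {N₁ : Type*} [TopologicalSpace N₁] [ChartedSpace H₁ N₁]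
    {V₂ : Type*} [NormedAddCommGroup V₂] [NormedSpace ℝ V₂]
    {H₂ : Type*} [TopologicalSpace H₂] {I₂ : ModelWithCorners ℝ V₂ H₂}
    {N₂ : Type*} [TopologicalSpace N₂] [ChartedSpace H₂ N₂] (g : N₁ → N₂) {p q : N₁}
    (h : p = q) (w : V₁) : (mfderiv I₁ I₂ g p w : V₂) = (mfderiv I₁ I₂ g q w : V₂) := by
  subst h
  rfl

lemma exists_verticalVector_eq (a : TotalSpace F E) : ∃ T : F →L[ℝ] V × F, ∀ b : E a.proj,
    (verticalVector I a b : V × F) = T (trivializationAt F E a.proj ⟨a.proj, b⟩).2 := by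
  set e := trivializationAt F E a.proj
  refine ⟨(mfderiv 𝓘(ℝ, F) (I.prod 𝓘(ℝ, F))
        (fun w : F => (⟨a.proj, e.symm a.proj w⟩ : TotalSpace F E)) (e a).2 : F →L[ℝ] V × F),
    fun b => ?_⟩
  rw [verticalVector, curve_eq]
  rw [mfderiv_comp_of_eq (y := (e a).2) (I' := 𝓘(ℝ, F))]
  · have : HasFDerivAt (fun t : ℝ => (e a).2 + t • (e ⟨a.proj, b⟩).2)
      ((ContinuousLinearMap.id ℝ ℝ).smulRight (e ⟨a.proj, b⟩).2) 0 :=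
        ((hasFDerivAt_id (0 : ℝ)).smul_const _).const_add _
    rw [mfderiv_eq_fderiv, this.fderiv]
    change (mfderiv 𝓘(ℝ, F) (I.prod 𝓘(ℝ, F))
      (fun w : F => (⟨a.proj, e.symm a.proj w⟩ : TotalSpace F E))
      ((e a).2 + (0 : ℝ) • (e ⟨a.proj, b⟩).2) ((1 : ℝ) • (e ⟨a.proj, b⟩).2) : V × F) = _
    refine (mfderiv_congr_point (I₁ := 𝓘(ℝ, F)) (I₂ := I.prod 𝓘(ℝ, F))
      (fun w : F => (⟨a.proj, e.symm a.proj w⟩ : TotalSpace F E))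
      (p := (e a).2 + (0 : ℝ) • (e ⟨a.proj, b⟩).2) (q := (e a).2) (by simp)
      ((1 : ℝ) • (e ⟨a.proj, b⟩).2)).trans ?_
    rw [one_smul]
    rfl
  · exact ((contMDiff_fiber I F a.proj).mdifferentiable (by simp)) _
  · exact DifferentiableAt.mdifferentiableAt (by fun_prop)
  · simp [e]

lemma verticalVector_add (a : TotalSpace F E) (b c : E a.proj) :
    verticalVector I a (b + c) = verticalVector I a b + verticalVector I a c := by
  have hm := FiberBundle.mem_baseSet_trivializationAt' (F := F) (E := E) a.proj
  obtain ⟨T, hT⟩ := exists_verticalVector_eq (I := I) a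
  refine (hT _).trans (Eq.trans ?_ (congrArg₂ (· + ·) (hT b) (hT c)).symm)
  rw [((trivializationAt F E a.proj).linear ℝ hm).map_add, map_add]
  rfl

lemma verticalVector_smul (a : TotalSpace F E) (r : ℝ) (b : E a.proj) :
    verticalVector I a (r • b) = r • verticalVector I a b := by
  have hm := FiberBundle.mem_baseSet_trivializationAt' (F := F) (E := E) a.proj
  obtain ⟨T, hT⟩ := exists_verticalVector_eq (I := I) a
  refine (hT _).trans (Eq.trans ?_ (congrArg (r • ·) (hT b)).symm)
  rw [((trivializationAt F E a.proj).linear ℝ hm).map_smul, map_smul]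
  rfl

/-- Derivative of a map along a vertical vector. -/
lemma mfderiv_verticalVector {V' : Type*} [NormedAddCommGroup V'] [NormedSpace ℝ V']
    {H' : Type*} [TopologicalSpace H'] {I' : ModelWithCorners ℝ V' H'}
    {N : Type*} [TopologicalSpace N] [ChartedSpace H' N] (g : TotalSpace F E → N)
    (a : TotalSpace F E) (b : E a.proj) (hg : MDifferentiableAt (I.prod 𝓘(ℝ, F)) I' g a) :
    (mfderiv (I.prod 𝓘(ℝ, F)) I' g a (verticalVector I a b) : V') =
      (mfderiv 𝓘(ℝ, ℝ) I' (fun t : ℝ => g ⟨a.proj, a.snd + t • b⟩) 0 (1 : ℝ) : V') := by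
  have h := mfderiv_comp_of_eq (I := 𝓘(ℝ, ℝ)) (I' := I.prod 𝓘(ℝ, F)) (I'' := I') (x := (0 : ℝ)) (y := a)
    (g := g) (f := fun t : ℝ => (⟨a.proj, a.snd + t • b⟩ : TotalSpace F E)) hg
    ((contMDiff_curve I a b).mdifferentiable (by simp) 0) (by simp)
  change _ = mfderiv 𝓘(ℝ, ℝ) I' (g ∘ fun t : ℝ => (⟨a.proj, a.snd + t • b⟩ : TotalSpace F E)) 0 (1 : ℝ)
  rw [h]
  exact mfderiv_congr_point g (by simp) _

lemma mfderiv_proj_verticalVector (a : TotalSpace F E) (b : E a.proj) :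
    mfderiv (I.prod 𝓘(ℝ, F)) I (π F E) a (verticalVector I a b) = 0 := by
  have := mfderiv_verticalVector (I := I) (I' := I) (π F E) a b
    ((contMDiff_proj E (n := 1)).mdifferentiableAt (by simp))
  refine Eq.trans this ?_
  change mfderiv 𝓘(ℝ, ℝ) I (fun t : ℝ => a.proj) 0 (1 : ℝ) = 0
  rw [mfderiv_const]
  rfl

lemma contMDiff_translate (σ : Cₛ^∞⟮I; F, E⟯) :
    ContMDiff (𝓘(ℝ, ℝ).prod (I.prod 𝓘(ℝ, F))) (I.prod 𝓘(ℝ, F)) ∞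
      (fun q : ℝ × TotalSpace F E =>
        (⟨q.2.proj, q.2.snd + q.1 • σ q.2.proj⟩ : TotalSpace F E)) := by
  rintro ⟨t, p⟩
  rw [contMDiffAt_totalSpace]
  have h1 : ContMDiffAt (𝓘(ℝ, ℝ).prod (I.prod 𝓘(ℝ, F))) I ∞
      (fun q : ℝ × TotalSpace F E => q.2.proj) (t, p) :=
    (contMDiff_proj E).contMDiffAt.comp (t, p) contMDiffAt_snd
  refine ⟨h1, ?_⟩
  set e := trivializationAt F E p.proj
  have hp : p.proj ∈ e.baseSet := FiberBundle.mem_baseSet_trivializationAt' _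
  have h2 : ContMDiffAt (𝓘(ℝ, ℝ).prod (I.prod 𝓘(ℝ, F))) 𝓘(ℝ, F) ∞
      (fun q : ℝ × TotalSpace F E => (e q.2).2) (t, p) :=
    (contMDiffAt_totalSpace.1 (contMDiffAt_snd (I := 𝓘(ℝ, ℝ)) (J := I.prod 𝓘(ℝ, F)) (p := (t, p)))).2
  have h3 : ContMDiffAt (𝓘(ℝ, ℝ).prod (I.prod 𝓘(ℝ, F))) 𝓘(ℝ, F) ∞
      (fun q : ℝ × TotalSpace F E => (e ⟨q.2.proj, σ q.2.proj⟩).2) (t, p) := by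
    have := ((contMDiffAt_totalSpace.1 (σ.contMDiff p.proj)).2)
    exact ContMDiffAt.comp (I' := I) (g := fun x => (e ⟨x, σ x⟩).2)
      (f := fun q : ℝ × TotalSpace F E => q.2.proj) (t, p) this h1
  refine (h2.add (contMDiffAt_fst.smul h3)).congr_of_eventuallyEq ?_
  filter_upwards [h1.continuousAt.preimage_mem_nhds (e.open_baseSet.mem_nhds hp)] with q hq
  change (e ⟨q.2.proj, q.2.snd + q.1 • σ q.2.proj⟩).2 = (e q.2).2 + q.1 • _
  rw [(e.linear ℝ hq).map_add, (e.linear ℝ hq).map_smul]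

/-- The vertical lift of a section of `E`, a vector field on `E`. -/
def verticalField (σ : Cₛ^∞⟮I; F, E⟯) :
    Cₛ^∞⟮I.prod 𝓘(ℝ, F); V × F,
      (TangentSpace (I.prod 𝓘(ℝ, F)) : TotalSpace F E → Type _)⟯ :=
  ⟨fun a => verticalVector I a (σ a.proj), by
    have h0 := contMDiff_translate σ
    have h1 := h0.contMDiff_tangentMap (m := ∞) (by simp)
    have h2 : ContMDiff (I.prod 𝓘(ℝ, F)) (I.prod 𝓘(ℝ, F)).tangent ∞
        (fun p : TotalSpace F E => (⟨p, 0⟩ : TangentBundle (I.prod 𝓘(ℝ, F)) (TotalSpace F E))) :=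
      contMDiff_zeroSection ℝ (TangentSpace (I.prod 𝓘(ℝ, F)) : TotalSpace F E → Type _)
    have h3 : ContMDiff (I.prod 𝓘(ℝ, F)) 𝓘(ℝ, ℝ).tangent ∞
        (fun p : TotalSpace F E => (⟨0, (1 : ℝ)⟩ : TangentBundle 𝓘(ℝ, ℝ) ℝ)) := contMDiff_const
    have h4 := (contMDiff_equivTangentBundleProd_symm (n := ∞) (I := 𝓘(ℝ, ℝ)) (M := ℝ)
      (I' := I.prod 𝓘(ℝ, F)) (M' := TotalSpace F E)).comp (h3.prodMk h2)
    have h5 := h1.comp h4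
    convert h5 using 1
    funext p
    have hp : (⟨p.proj, p.snd + (0 : ℝ) • σ p.proj⟩ : TotalSpace F E) = p := by simp
    have h6 := mfderiv_comp (I := 𝓘(ℝ, ℝ)) (I' := 𝓘(ℝ, ℝ).prod (I.prod 𝓘(ℝ, F)))
      (I'' := I.prod 𝓘(ℝ, F)) (0 : ℝ)
      (g := fun q : ℝ × TotalSpace F E =>
        (⟨q.2.proj, q.2.snd + q.1 • σ q.2.proj⟩ : TotalSpace F E))
      (f := fun t : ℝ => (t, p)) (h0.mdifferentiable (by simp) _)
      (mdifferentiableAt_id.prodMk mdifferentiableAt_const)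
    have h7 : verticalVector I p (σ p.proj) = mfderiv (𝓘(ℝ, ℝ).prod (I.prod 𝓘(ℝ, F)))
      (I.prod 𝓘(ℝ, F)) (fun q : ℝ × TotalSpace F E =>
        (⟨q.2.proj, q.2.snd + q.1 • σ q.2.proj⟩ : TotalSpace F E)) (0, p) ((1 : ℝ), (0 : V × F)) := by
      unfold verticalVector
      refine (congrArg (fun T : ℝ →L[ℝ] V × F => T 1) h6).trans ?_
      rw [mfderiv_prod_left]
      rfl
    have : ∀ (p q : TotalSpace F E) (v w : V × F), p = q → v = w →
      (⟨p, v⟩ : TangentBundle (I.prod 𝓘(ℝ, F)) (TotalSpace F E)) = ⟨q, w⟩ := by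
      rintro p q v w rfl rfl
      rfl
    exact this _ _ _ _ hp.symm h7⟩

section Tensoriality

lemma exists_fun_eventuallyEq {m : M} {U : Set M} (hU : IsOpen U) (hm : m ∈ U) (g : M → ℝ)
    (hg : ContMDiffOn I 𝓘(ℝ, ℝ) ∞ g U) : ∃ f : C^∞⟮I, M; ℝ⟯, ∀ᶠ y in 𝓝 m, f y = g y := by
  obtain ⟨χ, h1, h2⟩ := exists_bump I (hU.mem_nhds hm)
  refine ⟨⟨fun y => χ y * g y, ?_⟩, ?_⟩
  · intro y
    by_cases hy : y ∈ U
    · exact χ.contMDiff.contMDiffAt.mul (hg.contMDiffAt (hU.mem_nhds hy))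
    · have h3 : χ =ᶠ[𝓝 y] 0 := notMem_tsupport_iff_eventuallyEq.1 fun h => hy (h1 h)
      refine (contMDiffAt_const (c := (0 : ℝ))).congr_of_eventuallyEq ?_
      filter_upwards [h3] with z hz
      simp [hz]
  · filter_upwards [h2] with y hy
    change χ y * g y = g y
    rw [hy, one_mul]

lemma LieAlgebroid.bracket_congr (A : LieAlgebroid I F E) (σ : Cₛ^∞⟮I; F, E⟯)
    {η ζ : Cₛ^∞⟮I; F, E⟯} {m : M} (h : ∀ᶠ y in 𝓝 m, η y = ζ y) :
    A.bracket σ η m = A.bracket σ ζ m := by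
  obtain ⟨χ, h1, h2⟩ := exists_bump I h
  have h3 : funSMul χ (η - ζ) = 0 := by
    ext y
    by_cases hy : y ∈ tsupport χ
    · have : η y = ζ y := h1 hy
      simp [funSMul_apply, this]
    · simp [funSMul_apply, image_eq_zero_of_notMem_tsupport hy]
  have h4 := A.leibniz σ (η - ζ) χ m
  have h5 : η m = ζ m := h.self_of_nhds
  rw [h3, h2.self_of_nhds] at h4
  simp only [map_zero, map_sub, h5, ContMDiffSection.coe_sub, Pi.sub_apply, sub_self, smul_zero,
    add_zero, one_smul, ContMDiffSection.coe_zero, Pi.zero_apply] at h4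
  exact sub_eq_zero.1 h4.symm

/-- If a section vanishes at `m` then it is a combination of sections with coefficients that
vanish at `m`, and this determines its brackets at `m`. -/
lemma LieAlgebroid.exists_bracket_eq_sum (A : LieAlgebroid I F E) (σ ζ : Cₛ^∞⟮I; F, E⟯) (m : M)
    (hζ : ζ m = 0) : ∃ (k : ℕ) (f : Fin k → C^∞⟮I, M; ℝ⟯) (s : Fin k → Cₛ^∞⟮I; F, E⟯),
      (∀ i, f i m = 0) ∧ (∀ᶠ y in 𝓝 m, ζ y = ∑ i, f i y • s i y) ∧
      A.bracket σ ζ m = ∑ i, mvfderiv I (f i) m (A.anchor m (σ m)) • s i m := by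
  set e := trivializationAt F E m
  have hm : m ∈ e.baseSet := FiberBundle.mem_baseSet_trivializationAt' m
  set b := Module.finBasis ℝ F
  have hc : ∀ i, ContMDiffOn I 𝓘(ℝ, ℝ) ∞ (fun y => b.repr (e ⟨y, ζ y⟩).2 i) e.baseSet := by
    intro i
    have h1 := e.contMDiffOn_section_baseSet_iff.1 (ζ.contMDiff.contMDiffOn (s := e.baseSet))
    exact (LinearMap.toContinuousLinearMap (b.coord i)).contMDiff.comp_contMDiffOn h1
  choose f hf using fun i => exists_fun_eventuallyEq e.open_baseSet hm _ (hc i)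
  choose s hs using fun i => exists_section_eventuallyEq I e.open_baseSet hm _
    (contMDiffOn_symm_const I F e (fun _ => b i) contMDiffOn_const)
  have hfm : ∀ i, f i m = 0 := by
    intro i
    rw [(hf i).self_of_nhds, hζ, (e.linear ℝ hm).map_zero]
    simp
  have hsum : ∀ᶠ y in 𝓝 m, ζ y = ∑ i, f i y • s i y := by
    filter_upwards [eventually_all.2 hf, eventually_all.2 hs, e.open_baseSet.mem_nhds hm]
      with y h1 h2 hy
    simp only [h1, h2]
    have h3 : (e ⟨y, ζ y⟩).2 = ∑ i, b.repr (e ⟨y, ζ y⟩).2 i • b i := (b.sum_repr _).symm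
    have h4 : ζ y = e.symm y (e ⟨y, ζ y⟩).2 := (e.symm_apply_apply_mk hy _).symm
    rw [← e.symmL_apply (R := ℝ) hy] at h4
    conv_lhs => rw [h4, h3]
    rw [map_sum]
    refine Finset.sum_congr rfl fun i _ => ?_
    rw [map_smul, e.symmL_apply hy]
  refine ⟨_, f, s, hfm, hsum, ?_⟩
  have h1 : A.bracket σ ζ m = A.bracket σ (∑ i, funSMul (f i) (s i)) m := by
    apply A.bracket_congr
    filter_upwards [hsum] with y hy
    rw [hy]
    have := map_sum (ContMDiffSection.coeAddHom I F ∞ E) (fun i => funSMul (f i) (s i)) Finset.univ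
    have := congrFun this y
    rw [Finset.sum_apply] at this
    exact this.symm
  have h2 : ∀ (g : Fin (Module.finrank ℝ F) → Cₛ^∞⟮I; F, E⟯) (y : M), (∑ i, g i) y = ∑ i, g i y := by
    intro g y
    have := congrFun (map_sum (ContMDiffSection.coeAddHom I F ∞ E) g Finset.univ) y
    rw [Finset.sum_apply] at this
    exact this
  rw [h1, map_sum, h2]
  refine Finset.sum_congr rfl fun i _ => ?_
  rw [A.leibniz, hfm i, zero_smul, zero_add]

lemma mvfderiv_sum {V' : Type*} [NormedAddCommGroup V'] [NormedSpace ℝ V']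
    {H' : Type*} [TopologicalSpace H'] {I' : ModelWithCorners ℝ V' H'}
    {Q : Type*} [TopologicalSpace Q] [ChartedSpace H' Q] {ι : Type*} (t : Finset ι)
    {g : ι → Q → ℝ} {p : Q} (hg : ∀ i ∈ t, MDifferentiableAt I' 𝓘(ℝ, ℝ) (g i) p) :
    mvfderiv I' (fun y => ∑ i ∈ t, g i y) p = ∑ i ∈ t, mvfderiv I' (g i) p := by
  classical
  suffices h : MDifferentiableAt I' 𝓘(ℝ, ℝ) (fun y => ∑ i ∈ t, g i y) p ∧
    mvfderiv I' (fun y => ∑ i ∈ t, g i y) p = ∑ i ∈ t, mvfderiv I' (g i) p from h.2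
  induction t using Finset.induction_on with
  | empty => simpa using ⟨mdifferentiableAt_const, mvfderiv_const (0 : ℝ)⟩
  | insert i t hi ih =>
    have ih' := ih fun j hj => hg j (Finset.mem_insert_of_mem hj)
    have h0 := hg i (Finset.mem_insert_self i t)
    simp only [Finset.sum_insert hi]
    exact ⟨h0.add ih'.1, by rw [mvfderiv_fun_add h0 ih'.1, ih'.2]⟩

/-- Key fact for the independence of the choice of sections. -/
lemma LieAlgebroid.mvfderiv_pairing_of_apply_eq_zero (A : LieAlgebroid I F E)
    {V' : Type*} [NormedAddCommGroup V'] [NormedSpace ℝ V']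
    {H' : Type*} [TopologicalSpace H'] {I' : ModelWithCorners ℝ V' H'}
    {Q : Type*} [TopologicalSpace Q] [ChartedSpace H' Q] (q : Q → M) (p : Q)
    (hq : MDifferentiableAt I' I q p)
    (P : ∀ y : Q, E (q y) →ₗ[ℝ] ℝ)
    (hP : ∀ η : Cₛ^∞⟮I; F, E⟯, MDifferentiableAt I' 𝓘(ℝ, ℝ) (fun y => P y (η (q y))) p)
    (σ ζ : Cₛ^∞⟮I; F, E⟯) (hζ : ζ (q p) = 0) (v : TangentSpace I' p)
    (hv : mfderiv I' I q p v = A.anchor (q p) (σ (q p))) :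
    mvfderiv I' (fun y => P y (ζ (q y))) p v = P p (A.bracket σ ζ (q p)) := by
  obtain ⟨k, f, s, hf, hsum, hbr⟩ := A.exists_bracket_eq_sum σ ζ (q p) hζ
  have hfd : ∀ i, MDifferentiableAt I' 𝓘(ℝ, ℝ) (fun y => f i (q y)) p := fun i =>
    ((f i).contMDiff.mdifferentiable (by simp) (q p)).comp p hq
  have h1 : (fun y => P y (ζ (q y))) =ᶠ[𝓝 p] fun y => ∑ i, f i (q y) * P y (s i (q y)) := by
    filter_upwards [hq.continuousAt.eventually hsum] with y hy
    rw [hy, map_sum]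
    simp
  have h3 : mvfderiv I' (fun y => P y (ζ (q y))) p v =
      mvfderiv I' (fun y => ∑ i, f i (q y) * P y (s i (q y))) p v := by
    unfold mvfderiv
    rw [h1.mfderiv_eq]
    rfl
  rw [h3, mvfderiv_sum (g := fun i y => f i (q y) * P y (s i (q y))) Finset.univ
    fun i _ => (hfd i).mul (hP (s i)), hbr, map_sum]
  simp only [sum_apply]
  refine Finset.sum_congr rfl fun i _ => ?_
  rw [mvfderiv_fun_mul (hfd i) (hP (s i)), hf i]
  have h4 := mvfderiv_comp_apply (I := I) (I' := I') (g := f i) (f := q) p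
    ((f i).contMDiff.mdifferentiable (by simp) (q p)) hq v
  rw [hv] at h4
  have h5 : mvfderiv I' (fun y => f i (q y)) p v = mvfderiv I (f i) (q p) (A.anchor (q p) (σ (q p))) := h4
  simp [h5, mul_comm]

end Tensoriality

section Charts

variable (I) in
lemma trivializationAt_eq_mfderiv {N : Type*} [TopologicalSpace N] [ChartedSpace H N]
    [IsManifold I 1 N] {a p : N} (hp : p ∈ (chartAt H a).source) (v : TangentSpace I p) :
    ((trivializationAt V (TangentSpace I) a ⟨p, v⟩).2 : V) =
      (mfderiv I 𝓘(ℝ, V) (extChartAt I a) p v : V) := by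
  have h := TangentBundle.continuousLinearMapAt_trivializationAt (I := I) hp
  have h2 := congrArg (fun T : TangentSpace I p →L[ℝ] V => T v) h
  refine Eq.trans ?_ h2
  exact (Trivialization.continuousLinearMapAt_apply_of_mem ℝ (trivializationAt V (TangentSpace I) a)
    (by simpa using hp) v).symm

lemma mem_chart_source_iff (a p : TotalSpace F E) :
    p ∈ (chartAt (ModelProd H F) a).source ↔
      p.proj ∈ (trivializationAt F E a.proj).baseSet ∧ p.proj ∈ (chartAt H a.proj).source := by
  rw [FiberBundle.chartedSpace_chartAt]
  simp only [mfld_simps, Trivialization.mem_source]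
  constructor
  · rintro ⟨h1, h2⟩
    exact ⟨h1, by rwa [(trivializationAt F E a.proj).coe_fst' h1] at h2⟩
  · rintro ⟨h1, h2⟩
    exact ⟨h1, by rwa [(trivializationAt F E a.proj).coe_fst' h1]⟩

/-- In the charts, the derivative of the bundle projection is the first projection. -/
lemma fst_mfderiv_extChartAt (a p : TotalSpace F E)
    (hp : p ∈ (chartAt (ModelProd H F) a).source) (v : TangentSpace (I.prod 𝓘(ℝ, F)) p) :
    ((mfderiv (I.prod 𝓘(ℝ, F)) 𝓘(ℝ, V × F) (extChartAt (I.prod 𝓘(ℝ, F)) a) p v : V × F)).1 =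
      (mfderiv I 𝓘(ℝ, V) (extChartAt I a.proj) p.proj
        (mfderiv (I.prod 𝓘(ℝ, F)) I (π F E) p v) : V) := by
  have hp' := (mem_chart_source_iff a p).1 hp
  have h1 : (fun y => ((extChartAt (I.prod 𝓘(ℝ, F)) a) y : V × F).1) =ᶠ[𝓝 p]
      (extChartAt I a.proj) ∘ (π F E) := by
    filter_upwards [(chartAt (ModelProd H F) a).open_source.mem_nhds hp] with y hy
    rw [mem_chart_source_iff] at hy
    rw [FiberBundle.extChartAt]
    simp [(trivializationAt F E a.proj).coe_fst' hy.1]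
  have h2 : MDifferentiableAt (I.prod 𝓘(ℝ, F)) 𝓘(ℝ, V × F) (extChartAt (I.prod 𝓘(ℝ, F)) a) p :=
    mdifferentiableAt_extChartAt hp
  have h3 := mfderiv_comp p (I'' := 𝓘(ℝ, V)) (g := (Prod.fst : V × F → V))
    (differentiableAt_fst.mdifferentiableAt) h2
  have h4 := mfderiv_comp p (I := I.prod 𝓘(ℝ, F)) (I' := I) (I'' := 𝓘(ℝ, V))
    (g := extChartAt I a.proj) (f := π F E)
    (mdifferentiableAt_extChartAt (by simpa using hp'.2))
    ((contMDiff_proj E (n := 1)).mdifferentiableAt (by simp))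
  have h5 : mfderiv (I.prod 𝓘(ℝ, F)) 𝓘(ℝ, V)
    (Prod.fst ∘ (extChartAt (I.prod 𝓘(ℝ, F)) a)) p =
      mfderiv (I.prod 𝓘(ℝ, F)) 𝓘(ℝ, V) ((extChartAt I a.proj) ∘ (π F E)) p := h1.mfderiv_eq
  rw [h3, h4] at h5
  have h6 := congrArg (fun T : V × F →L[ℝ] V => T v) h5
  rw [mfderiv_eq_fderiv, fderiv_fst] at h6
  exact h6

lemma fst_trivializationAt (a p : TotalSpace F E)
    (hp : p ∈ (chartAt (ModelProd H F) a).source) (v : TangentSpace (I.prod 𝓘(ℝ, F)) p) :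
    ((trivializationAt (V × F) (TangentSpace (I.prod 𝓘(ℝ, F))) a ⟨p, v⟩).2).1 =
      (trivializationAt V (TangentSpace I) a.proj
        ⟨p.proj, mfderiv (I.prod 𝓘(ℝ, F)) I (π F E) p v⟩).2 := by
  have hp' := (mem_chart_source_iff a p).1 hp
  have h := fst_mfderiv_extChartAt a p hp v
  rw [trivializationAt_eq_mfderiv I hp'.2]
  refine Eq.trans ?_ h
  exact congrArg Prod.fst (trivializationAt_eq_mfderiv (I.prod 𝓘(ℝ, F)) hp v)

end Charts

variable (I E) in
/-- A linear choice of smooth sections through the points of a fibre. -/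
lemma exists_linear_sections (m : M) :
    ∃ s : E m →ₗ[ℝ] Cₛ^∞⟮I; F, E⟯, ∀ b, s b m = b := by
  have h : ∀ x : M, ∀ b : E x, ∃ σ : Cₛ^∞⟮I; F, E⟯, σ x = b := exists_section_through I F
  have e := (trivializationAt F E m).continuousLinearEquivAt ℝ m
    (FiberBundle.mem_baseSet_trivializationAt' m)
  have : FiniteDimensional ℝ (E m) := e.symm.toLinearEquiv.finiteDimensional
  let b := Module.finBasis ℝ (E m)
  choose σ hσ using fun i => h m (b i)
  refine ⟨b.constr ℝ σ, fun x => ?_⟩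
  let ev : Cₛ^∞⟮I; F, E⟯ →ₗ[ℝ] E m :=
    { toFun := fun s => s m, map_add' := fun _ _ => rfl, map_smul' := fun _ _ => rfl }
  have : ev.comp (b.constr ℝ σ) = LinearMap.id := by
    refine b.ext fun i => ?_
    simp [ev, hσ]
  exact congrArg (fun T : E m →ₗ[ℝ] E m => T x) this

/-- `v L` for the vertical lift of a section. -/
def fiberDeriv (L : C^∞⟮I.prod 𝓘(ℝ, F), TotalSpace F E; ℝ⟯) (σ : Cₛ^∞⟮I; F, E⟯) :
    C^∞⟮I.prod 𝓘(ℝ, F), TotalSpace F E; ℝ⟯ :=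
  fieldDeriv (verticalField σ) L

lemma fiberDeriv_apply (L : C^∞⟮I.prod 𝓘(ℝ, F), TotalSpace F E; ℝ⟯) (σ : Cₛ^∞⟮I; F, E⟯)
    (a : TotalSpace F E) : fiberDeriv L σ a =
      mvfderiv (I.prod 𝓘(ℝ, F)) L a (verticalVector I a (σ a.proj)) := rfl

/-- The vectors tangent to `E` are determined by their projection and the derivatives of
fibrewise linear functions. -/
lemma tangent_totalSpace_ext {a : TotalSpace F E} {v w : TangentSpace (I.prod 𝓘(ℝ, F)) a}
    (h1 : mfderiv (I.prod 𝓘(ℝ, F)) I (π F E) a v = mfderiv (I.prod 𝓘(ℝ, F)) I (π F E) a w)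
    (h2 : ∀ μ : ∀ x : M, E x →ₗ[ℝ] ℝ, ContMDiff (I.prod 𝓘(ℝ, F)) 𝓘(ℝ, ℝ) ∞
      (fun p : TotalSpace F E => μ p.proj p.snd) →
      mvfderiv (I.prod 𝓘(ℝ, F)) (fun p : TotalSpace F E => μ p.proj p.snd) a v =
      mvfderiv (I.prod 𝓘(ℝ, F)) (fun p : TotalSpace F E => μ p.proj p.snd) a w) : v = w := by
  have ha := mem_chart_source (ModelProd H F) a
  have e1 := fst_mfderiv_extChartAt a a ha v
  have e2 := fst_mfderiv_extChartAt a a ha w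
  rw [h1, ← e2, mfderiv_extChartAt_self] at e1
  have f1 : (v : V × F).1 = (w : V × F).1 := e1
  set e := trivializationAt F E a.proj
  have hm : a.proj ∈ e.baseSet := FiberBundle.mem_baseSet_trivializationAt' _
  obtain ⟨χ, hχ1, hχ2⟩ := exists_bump I (e.open_baseSet.mem_nhds hm)
  have f2 : ∀ l : F →L[ℝ] ℝ, l (v : V × F).2 = l (w : V × F).2 := by
    intro l
    let μ : ∀ x : M, E x →ₗ[ℝ] ℝ := fun x => χ x • l.toLinearMap.comp (e.linearMapAt ℝ x)
    have hμ : ∀ p : TotalSpace F E, p.proj ∈ e.baseSet → μ p.proj p.snd = χ p.proj * l (e p).2 := by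
      intro p hp
      simp [μ, hp]
    have hs : ContMDiff (I.prod 𝓘(ℝ, F)) 𝓘(ℝ, ℝ) ∞ (fun p : TotalSpace F E => μ p.proj p.snd) := by
      intro p
      by_cases hp : p.proj ∈ e.baseSet
      · have g1 : ContMDiffAt (I.prod 𝓘(ℝ, F)) 𝓘(ℝ, F) ∞ (fun q : TotalSpace F E => (e q).2) p :=
          ((e.contMDiffAt_iff (f := id) (x₀ := p) (e.mem_source.2 hp)).1 contMDiffAt_id).2
        have g2 : ContMDiffAt (I.prod 𝓘(ℝ, F)) 𝓘(ℝ, ℝ) ∞ (fun q : TotalSpace F E => χ q.proj) p :=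
          (χ.contMDiff.comp (contMDiff_proj E)).contMDiffAt
        have g3 : ContMDiffAt (I.prod 𝓘(ℝ, F)) 𝓘(ℝ, ℝ) ∞
            (fun q : TotalSpace F E => l (e q).2) p :=
          ContMDiffAt.comp (I' := 𝓘(ℝ, F)) (g := l) (f := fun q : TotalSpace F E => (e q).2) p
            l.contMDiff.contMDiffAt g1
        refine (g2.mul g3).congr_of_eventuallyEq ?_
        filter_upwards [(e.open_baseSet.preimage (FiberBundle.continuous_proj F E)).mem_nhds hp]
          with q hq using hμ q hq
      · have h3 : χ =ᶠ[𝓝 p.proj] 0 := notMem_tsupport_iff_eventuallyEq.1 fun h => hp (hχ1 h)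
        refine (contMDiffAt_const (c := (0 : ℝ))).congr_of_eventuallyEq ?_
        filter_upwards [(FiberBundle.continuous_proj F E).continuousAt.eventually h3] with z hz
        simp [μ, hz]
    have h3 := h2 μ hs
    have h4 : (fun p : TotalSpace F E => μ p.proj p.snd) =ᶠ[𝓝 a]
        (l.comp (ContinuousLinearMap.snd ℝ V F)) ∘ (extChartAt (I.prod 𝓘(ℝ, F)) a) := by
      filter_upwards [(FiberBundle.continuous_proj F E).continuousAt.eventually hχ2,
        (e.open_baseSet.preimage (FiberBundle.continuous_proj F E)).mem_nhds hm] with q hq1 hq2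
      rw [hμ q hq2, hq1, FiberBundle.extChartAt]
      simp [e]
    have h5 := mfderiv_comp a (I'' := 𝓘(ℝ, ℝ)) (g := (l.comp (ContinuousLinearMap.snd ℝ V F)))
      ((l.comp (ContinuousLinearMap.snd ℝ V F)).mdifferentiableAt)
      (mdifferentiableAt_extChartAt (I := I.prod 𝓘(ℝ, F)) ha)
    have h6 : ∀ u : TangentSpace (I.prod 𝓘(ℝ, F)) a,
        mvfderiv (I.prod 𝓘(ℝ, F)) (fun p : TotalSpace F E => μ p.proj p.snd) a u =
          l (u : V × F).2 := by
      intro u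
      change (mfderiv (I.prod 𝓘(ℝ, F)) 𝓘(ℝ, ℝ) (fun p : TotalSpace F E => μ p.proj p.snd) a u : ℝ)
        = _
      have h7 : mfderiv (I.prod 𝓘(ℝ, F)) 𝓘(ℝ, ℝ) (fun p : TotalSpace F E => μ p.proj p.snd) a
        = mfderiv (I.prod 𝓘(ℝ, F)) 𝓘(ℝ, ℝ) ((l.comp (ContinuousLinearMap.snd ℝ V F)) ∘
          (extChartAt (I.prod 𝓘(ℝ, F)) a)) a := h4.mfderiv_eq
      have h8 := h7.trans h5
      rw [mfderiv_extChartAt_self, mfderiv_eq_fderiv, ContinuousLinearMap.fderiv] at h8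
      exact congrArg (fun T : V × F →L[ℝ] ℝ => T u) h8
    rw [h6, h6] at h3
    exact h3
  have f3 : (v : V × F).2 = (w : V × F).2 := by
    by_contra hne
    obtain ⟨l, hl⟩ := SeparatingDual.exists_separating_of_ne (R := ℝ) (V := F) hne
    exact hl (f2 l)
  exact Prod.ext f1 f3

namespace LieAlgebroid
variable (A : LieAlgebroid I F E)

/-- Every pair `(b, v)` with `ρ(b) = Tτ(v)` is the value of `(σ ∘ τ, X)` for a section `σ` of `E`
and a vector field `X` on `E` which projects to `ρ(σ)`. -/
lemma exists_projectable (a : TotalSpace F E) (b : E a.proj) (v : TangentSpace (I.prod 𝓘(ℝ, F)) a)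
    (hbv : A.anchor a.proj b = mfderiv (I.prod 𝓘(ℝ, F)) I (π F E) a v) :
    ∃ (σ : Cₛ^∞⟮I; F, E⟯) (X : Cₛ^∞⟮I.prod 𝓘(ℝ, F); V × F,
      (TangentSpace (I.prod 𝓘(ℝ, F)) : TotalSpace F E → Type _)⟯), σ a.proj = b ∧ X a = v ∧
      ∀ p : TotalSpace F E, A.anchor p.proj (σ p.proj) =
        mfderiv (I.prod 𝓘(ℝ, F)) I (π F E) p (X p) := by
  obtain ⟨η, hη⟩ := exists_section_through I F a.proj b
  set tE := trivializationAt (V × F) (TangentSpace (I.prod 𝓘(ℝ, F))) a with htE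
  set tM := trivializationAt V (TangentSpace I) a.proj with htM
  have hbE : tE.baseSet = (chartAt (ModelProd H F) a).source := rfl
  have hbM : tM.baseSet = (chartAt H a.proj).source := rfl
  have ha : a ∈ tE.baseSet := mem_chart_source (ModelProd H F) a
  set U : Set M := (trivializationAt F E a.proj).baseSet ∩ (chartAt H a.proj).source
  have hU : IsOpen U := (trivializationAt F E a.proj).open_baseSet.inter (chartAt H a.proj).open_source
  have hEU : ∀ p : TotalSpace F E, p ∈ tE.baseSet ↔ p.proj ∈ U := mem_chart_source_iff a
  obtain ⟨χ, hχ1, hχ2⟩ := exists_bump I (hU.mem_nhds ((hEU a).1 ha))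
  let c : F := ((tE ⟨a, v⟩).2).2
  let w : TotalSpace F E → V × F := fun p => ((tM ⟨p.proj, A.anchor p.proj (η p.proj)⟩).2, c)
  have hw : ContMDiffOn (I.prod 𝓘(ℝ, F)) 𝓘(ℝ, V × F) ∞ w tE.baseSet := by
    have h1 := tM.contMDiffOn_section_baseSet_iff.1
      ((A.anchorField η).contMDiff.contMDiffOn (s := tM.baseSet))
    have h2 := h1.comp (contMDiff_proj E).contMDiffOn
      (s := tE.baseSet) (fun p hp => ((hEU p).1 hp).2)
    exact h2.prodMk_space contMDiffOn_const
  have := t2Space_totalSpace F E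
  have hX := contMDiffOn_symm_const (I.prod 𝓘(ℝ, F)) (V × F) tE w hw
  let χ' : C^∞⟮I.prod 𝓘(ℝ, F), TotalSpace F E; ℝ⟯ := ⟨fun p => χ p.proj, χ.contMDiff.comp (contMDiff_proj E)⟩
  have hχ' : tsupport χ' ⊆ tE.baseSet := by
    intro p hp
    rw [hEU]
    exact hχ1 (tsupport_comp_subset_preimage χ (FiberBundle.continuous_proj F E) hp)
  refine ⟨funSMul χ η, ⟨fun p => χ' p • tE.symm p (w p),
    ContMDiffOn.smul_section_of_tsupport χ'.contMDiff.contMDiffOn tE.open_baseSet hχ' hX⟩, ?_, ?_, ?_⟩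
  · rw [funSMul_apply, hχ2.self_of_nhds, one_smul, hη]
  · change χ a.proj • tE.symm a (w a) = v
    rw [hχ2.self_of_nhds, one_smul]
    have h1 : w a = (tE ⟨a, v⟩).2 := by
      refine Prod.ext ?_ rfl
      rw [fst_trivializationAt a a ha v, ← hbv, ← hη]
    rw [h1, tE.symm_apply_apply_mk ha]
  · intro p
    change A.anchor p.proj (χ p.proj • η p.proj) =
      mfderiv (I.prod 𝓘(ℝ, F)) I (π F E) p (χ p.proj • tE.symm p (w p))
    rw [map_smul, map_smul]
    by_cases hp : p.proj ∈ U
    · congr 1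
      have hp' := (hEU p).2 hp
      have h1 := fst_trivializationAt a p hp' (tE.symm p (w p))
      rw [← htE, tE.apply_mk_symm hp'] at h1
      have h2 := congrArg (tM.symm p.proj) h1
      rw [← htM] at h2
      exact (tM.symm_apply_apply_mk hp.2 _).symm.trans (h2.trans (tM.symm_apply_apply_mk hp.2 _))
    · have : χ p.proj = 0 := image_eq_zero_of_notMem_tsupport fun h => hp (hχ1 h)
      rw [this, zero_smul, zero_smul]

end LieAlgebroid
variable (I F E) in
/-- A smooth section `μ` of the dual bundle `E*`; smoothness is that of the associated fibrewise
linear function on `E`. -/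
structure DualSection where
  toFun : ∀ x : M, E x →ₗ[ℝ] ℝ
  contMDiff_toFun : ContMDiff (I.prod 𝓘(ℝ, F)) 𝓘(ℝ, ℝ) ∞
    (fun a : TotalSpace F E => toFun a.proj a.snd)

/-- The linear function `a ↦ ⟨μ, a⟩` on `E` associated to a section `μ` of `E*`. -/
def DualSection.hat (μ : DualSection I F E) :
    C^∞⟮I.prod 𝓘(ℝ, F), TotalSpace F E; ℝ⟯ :=
  ⟨fun a => μ.toFun a.proj a.snd, μ.contMDiff_toFun⟩

/-- The function `⟨μ, σ⟩` on `M`. -/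
def DualSection.pair (μ : DualSection I F E) (σ : Cₛ^∞⟮I; F, E⟯) : C^∞⟮I, M; ℝ⟯ :=
  ⟨fun x => μ.toFun x (σ x), μ.contMDiff_toFun.comp σ.contMDiff⟩

namespace LieAlgebroid
variable (A : LieAlgebroid I F E)

/-- `dμ(σ, η)` for a section `μ` of `E*` and sections `σ`, `η` of `E`. -/
def dualExtDeriv (μ : DualSection I F E) (σ η : Cₛ^∞⟮I; F, E⟯) (x : M) : ℝ :=
  A.sectionDeriv σ (μ.pair η) x - A.sectionDeriv η (μ.pair σ) x - μ.pair (A.bracket σ η) x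

/-- The Lie derivative `d_σ μ = i_σ dμ + d i_σ μ` of a section `μ` of `E*`, evaluated on a
section `η` of `E`. -/
def dualLieDeriv (σ : Cₛ^∞⟮I; F, E⟯) (μ : DualSection I F E) (η : Cₛ^∞⟮I; F, E⟯) (x : M) : ℝ :=
  A.dualExtDeriv μ σ η x + A.sectionDeriv η (μ.pair σ) x

/-- The fibre at `a` of the prolongation (the `E`-tangent bundle of `E`): the pairs `(b, v)` with
`b ∈ E_{τ(a)}`, `v ∈ T_a E` and `ρ(b) = T_a τ (v)`. -/
def Prolongation (a : TotalSpace F E) :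
    Submodule ℝ (E a.proj × TangentSpace (I.prod 𝓘(ℝ, F)) a) :=
  LinearMap.ker ((A.anchor a.proj).comp (LinearMap.fst ℝ _ _) -
    (mfderiv (I.prod 𝓘(ℝ, F)) I (π F E) a).toLinearMap.comp
      (LinearMap.snd ℝ (E a.proj) (TangentSpace (I.prod 𝓘(ℝ, F)) a)))

lemma mem_prolongation {a : TotalSpace F E}
    {z : E a.proj × TangentSpace (I.prod 𝓘(ℝ, F)) a} :
    z ∈ A.Prolongation a ↔
      A.anchor a.proj z.1 = mfderiv (I.prod 𝓘(ℝ, F)) I (π F E) a z.2 := by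
  simp only [Prolongation, LinearMap.mem_ker, LinearMap.sub_apply, sub_eq_zero]
  rfl

lemma verticalVector_mem (a : TotalSpace F E) (b : E a.proj) :
    ((0 : E a.proj), verticalVector I a b) ∈ A.Prolongation a := by
  rw [A.mem_prolongation, map_zero]
  exact (mfderiv_proj_verticalVector a b).symm

/-- The vertical lift `ξ^V(a, b) = (a, 0, b_a^V)`. -/
def verticalLift (a : TotalSpace F E) : E a.proj →ₗ[ℝ] A.Prolongation a where
  toFun b := ⟨(0, verticalVector I a b), A.verticalVector_mem a b⟩
  map_add' b c := by
    ext1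
    simp [verticalVector_add]
  map_smul' r b := by
    ext1
    simp [verticalVector_smul]

/-- The vertical endomorphism `S(a, b, v) = ξ^V(a, b)`. -/
def verticalEndo (a : TotalSpace F E) : A.Prolongation a →ₗ[ℝ] A.Prolongation a :=
  (A.verticalLift a).comp ((LinearMap.fst ℝ _ _).comp (A.Prolongation a).subtype)

/-- The Liouville section `Δ(a) = ξ^V(a, a)`. -/
def liouville (a : TotalSpace F E) : A.Prolongation a := A.verticalLift a a.snd

/-- The differential `df` of a function on `E`, as a 1-form on the prolongation:
`df(a, b, v) = v f`. -/
def diff (f : TotalSpace F E → ℝ) (a : TotalSpace F E) : A.Prolongation a →ₗ[ℝ] ℝ :=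
  (mvfderiv (I.prod 𝓘(ℝ, F)) f a).toLinearMap.comp
    ((LinearMap.snd ℝ (E a.proj) (TangentSpace (I.prod 𝓘(ℝ, F)) a)).comp
      (A.Prolongation a).subtype)

/-- A projectable section of the prolongation: a section `Z(a) = (a, σ(τ(a)), X(a))` with `σ` a
section of `E` and `X` a vector field on `E` (which projects to `ρ(σ)`). -/
structure ProjectableSection where
  base : Cₛ^∞⟮I; F, E⟯
  field : Cₛ^∞⟮I.prod 𝓘(ℝ, F); V × F,
    (TangentSpace (I.prod 𝓘(ℝ, F)) : TotalSpace F E → Type _)⟯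
  mem : ∀ a : TotalSpace F E, (base a.proj, field a) ∈ A.Prolongation a

namespace ProjectableSection
variable {A}

/-- The value of a projectable section at a point. -/
def val (Z : A.ProjectableSection) (a : TotalSpace F E) : A.Prolongation a :=
  ⟨(Z.base a.proj, Z.field a), Z.mem a⟩

/-- The bracket `[Z, W] = ([σ, η], [X, Y])` of projectable sections. -/
def bracket (Z W : A.ProjectableSection) : A.ProjectableSection where
  base := A.bracket Z.base W.base
  field := (tangentLieAlgebroid (I.prod 𝓘(ℝ, F))).bracket Z.field W.field
  mem a := by
    have := t2Space_totalSpace F E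
    rw [mem_prolongation]
    refine tangent_ext I fun f => ?_
    let g : C^∞⟮I.prod 𝓘(ℝ, F), TotalSpace F E; ℝ⟯ :=
      ⟨fun p => f p.proj, f.contMDiff.comp (contMDiff_proj E)⟩
    have hc : ∀ (h : C^∞⟮I, M; ℝ⟯) (p : TotalSpace F E) (v : TangentSpace (I.prod 𝓘(ℝ, F)) p),
        mvfderiv (I.prod 𝓘(ℝ, F)) (fun q : TotalSpace F E => h q.proj) p v =
          mvfderiv I h p.proj (mfderiv (I.prod 𝓘(ℝ, F)) I (π F E) p v) := fun h p v =>
      mvfderiv_comp_apply (g := h) (f := π F E) p (h.contMDiff.mdifferentiable (by simp) _)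
        ((contMDiff_proj E (n := 1)).mdifferentiableAt (by simp)) v
    have hr : ∀ (Z : A.ProjectableSection),
        (fieldDeriv Z.field g : TotalSpace F E → ℝ) =
          fun p => A.sectionDeriv Z.base f p.proj := by
      intro Z
      funext p
      refine (hc f p _).trans ?_
      rw [← (A.mem_prolongation.1 (Z.mem p))]
      rfl
    have h1 := (tangentLieAlgebroid (I.prod 𝓘(ℝ, F))).mvfderiv_anchor_bracket Z.field W.field g a
    have h2 := A.mvfderiv_anchor_bracket Z.base W.base f a.proj
    refine h2.trans (Eq.trans ?_ (h1.symm.trans (hc f a _)))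
    change _ = mvfderiv (I.prod 𝓘(ℝ, F)) (fieldDeriv W.field g) a (Z.field a) -
      mvfderiv (I.prod 𝓘(ℝ, F)) (fieldDeriv Z.field g) a (W.field a)
    rw [hr, hr, hc, hc, ← (A.mem_prolongation.1 (Z.mem a)), ← (A.mem_prolongation.1 (W.mem a))]

end ProjectableSection

/-- `dθ(Z, W) = ρ¹(Z)(θ(W)) - ρ¹(W)(θ(Z)) - θ([Z, W])` for a 1-form `θ` on the prolongation and
projectable sections `Z`, `W`. -/
def extDeriv (θ : ∀ a : TotalSpace F E, A.Prolongation a →ₗ[ℝ] ℝ) (Z W : A.ProjectableSection)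
    (a : TotalSpace F E) : ℝ :=
  A.diff (fun p => θ p (W.val p)) a (Z.val a) - A.diff (fun p => θ p (Z.val p)) a (W.val a) -
    θ a ((Z.bracket W).val a)

variable (L : C^∞⟮I.prod 𝓘(ℝ, F), TotalSpace F E; ℝ⟯)

/-- The Cartan 1-form `θ_L = S^*(dL)`. -/
def cartanOneForm (a : TotalSpace F E) : A.Prolongation a →ₗ[ℝ] ℝ :=
  (A.diff L a).comp (A.verticalEndo a)

/-- The energy `E_L = d_Δ L - L`. -/
def energy (a : TotalSpace F E) : ℝ := A.diff L a (A.liouville a) - L a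

/-- Derivatives along vertical vectors as a linear map. -/
def verticalDeriv (p : TotalSpace F E) : E p.proj →ₗ[ℝ] ℝ :=
  (A.diff L p).comp (A.verticalLift p)

lemma fiberDeriv_eq (σ : Cₛ^∞⟮I; F, E⟯) :
    (fiberDeriv L σ : TotalSpace F E → ℝ) = fun p => A.verticalDeriv L p (σ p.proj) := rfl

lemma fiberDeriv_add (σ η : Cₛ^∞⟮I; F, E⟯) :
    fiberDeriv L (σ + η) = fiberDeriv L σ + fiberDeriv L η := by
  ext p
  exact (congrArg (mvfderiv (I.prod 𝓘(ℝ, F)) L p)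
    (verticalVector_add p (σ p.proj) (η p.proj))).trans (map_add _ _ _)

lemma fiberDeriv_smul (c : ℝ) (σ : Cₛ^∞⟮I; F, E⟯) :
    fiberDeriv L (c • σ) = c • fiberDeriv L σ := by
  ext p
  exact (congrArg (mvfderiv (I.prod 𝓘(ℝ, F)) L p)
    (verticalVector_smul p c (σ p.proj))).trans (map_smul _ _ _)

lemma mdifferentiableAt_fiberDeriv (σ : Cₛ^∞⟮I; F, E⟯) (a : TotalSpace F E) :
    MDifferentiableAt (I.prod 𝓘(ℝ, F)) 𝓘(ℝ, ℝ) (fiberDeriv L σ) a :=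
  (fiberDeriv L σ).contMDiff.mdifferentiable (by simp) a

/-- `d(v L)` at `a` for the vertical lift `v` of a section, as a bilinear map. -/
def fiberHessian (a : TotalSpace F E) : Cₛ^∞⟮I; F, E⟯ →ₗ[ℝ]
    TangentSpace (I.prod 𝓘(ℝ, F)) a →ₗ[ℝ] ℝ :=
  LinearMap.mk₂ ℝ (fun σ v => mvfderiv (I.prod 𝓘(ℝ, F)) (fiberDeriv L σ) a v)
    (fun σ η v => by
      rw [fiberDeriv_add]
      exact congrArg (fun T : TangentSpace (I.prod 𝓘(ℝ, F)) a →L[ℝ] ℝ => T v)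
        (mvfderiv_add (mdifferentiableAt_fiberDeriv L σ a) (mdifferentiableAt_fiberDeriv L η a)))
    (fun c σ v => by
      rw [fiberDeriv_smul]
      exact congrArg (fun T : V × F →L[ℝ] ℝ => T v)
        (const_smul_mfderiv (mdifferentiableAt_fiberDeriv L σ a) c))
    (fun σ v w => map_add _ _ _)
    (fun c σ v => map_smul _ _ _)

lemma bracket_antisymm (σ η : Cₛ^∞⟮I; F, E⟯) : A.bracket σ η = -A.bracket η σ := by
  have h := A.bracket_self (σ + η)
  simp only [map_add, LinearMap.add_apply, A.bracket_self, zero_add, add_zero] at h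
  rw [add_comm] at h
  exact eq_neg_of_add_eq_zero_left h

/-- Independence of the choice of a section with a given value. -/
lemma fiberHessian_sub (a : TotalSpace F E) (σ η ζ : Cₛ^∞⟮I; F, E⟯) (h : η a.proj = ζ a.proj)
    (v : TangentSpace (I.prod 𝓘(ℝ, F)) a)
    (hv : mfderiv (I.prod 𝓘(ℝ, F)) I (π F E) a v = A.anchor a.proj (σ a.proj)) :
    fiberHessian L a η v - fiberHessian L a ζ v =
      A.verticalDeriv L a (A.bracket σ η a.proj) - A.verticalDeriv L a (A.bracket σ ζ a.proj) := by
  have h1 := A.mvfderiv_pairing_of_apply_eq_zero (I' := I.prod 𝓘(ℝ, F)) (π F E) a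
    ((contMDiff_proj E (n := 1)).mdifferentiableAt (by simp)) (A.verticalDeriv L)
    (fun η => mdifferentiableAt_fiberDeriv L η a) σ (η - ζ)
    (by simp [h]) v hv
  have h2 : fiberHessian L a (η - ζ) v = A.verticalDeriv L a (A.bracket σ (η - ζ) a.proj) := h1
  rw [map_sub, map_sub] at h2
  exact h2.trans (map_sub (A.verticalDeriv L a) _ _)

/-- There is exactly one 2-form that takes the value `-dθ_L(Z, W)` on all projectable
sections. -/
theorem existsUnique_cartanTwoForm (a : TotalSpace F E) :
    ∃! w : A.Prolongation a →ₗ[ℝ] A.Prolongation a →ₗ[ℝ] ℝ,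
      ∀ Z W : A.ProjectableSection, w (Z.val a) (W.val a) =
        -A.extDeriv (A.cartanOneForm L) Z W a := by
  obtain ⟨s, hs⟩ := exists_linear_sections I E (F := F) a.proj
  let w : A.Prolongation a →ₗ[ℝ] A.Prolongation a →ₗ[ℝ] ℝ :=
    LinearMap.mk₂ ℝ (fun z z' => -(fiberHessian L a (s z'.1.1) z.1.2 -
      fiberHessian L a (s z.1.1) z'.1.2 -
        A.verticalDeriv L a (A.bracket (s z.1.1) (s z'.1.1) a.proj)))
      (fun z₁ z₂ z' => by
        simp only [Submodule.coe_add, Prod.fst_add, Prod.snd_add, map_add, LinearMap.add_apply,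
          ContMDiffSection.coe_add, Pi.add_apply]
        ring)
      (fun c z z' => by
        simp only [Submodule.coe_smul, Prod.smul_fst, Prod.smul_snd, map_smul,
          LinearMap.smul_apply, ContMDiffSection.coe_smul, Pi.smul_apply, smul_eq_mul]
        ring)
      (fun z₁ z₂ z' => by
        simp only [Submodule.coe_add, Prod.fst_add, Prod.snd_add, map_add, LinearMap.add_apply,
          ContMDiffSection.coe_add, Pi.add_apply]
        ring)
      (fun c z z' => by
        simp only [Submodule.coe_smul, Prod.smul_fst, Prod.smul_snd, map_smul,
          LinearMap.smul_apply, ContMDiffSection.coe_smul, Pi.smul_apply, smul_eq_mul]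
        ring)
  have hw : ∀ Z W : A.ProjectableSection, w (Z.val a) (W.val a) =
      -A.extDeriv (A.cartanOneForm L) Z W a := by
    intro Z W
    have h1 := A.fiberHessian_sub L a Z.base W.base (s (W.base a.proj)) (hs _).symm (Z.field a)
      (A.mem_prolongation.1 (Z.mem a)).symm
    have h2 := A.fiberHessian_sub L a (s (W.base a.proj)) Z.base (s (Z.base a.proj)) (hs _).symm
      (W.field a) (by rw [hs]; exact (A.mem_prolongation.1 (W.mem a)).symm)
    rw [A.bracket_antisymm (s (W.base a.proj)) Z.base,
      A.bracket_antisymm (s (W.base a.proj)) (s (Z.base a.proj))] at h2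
    simp only [ContMDiffSection.coe_neg, Pi.neg_apply, map_neg] at h2
    have h3 : A.extDeriv (A.cartanOneForm L) Z W a = fiberHessian L a W.base (Z.field a) -
      fiberHessian L a Z.base (W.field a) -
        A.verticalDeriv L a (A.bracket Z.base W.base a.proj) := rfl
    have h4 : w (Z.val a) (W.val a) = -(fiberHessian L a (s (W.base a.proj)) (Z.field a) -
      fiberHessian L a (s (Z.base a.proj)) (W.field a) -
        A.verticalDeriv L a (A.bracket (s (Z.base a.proj)) (s (W.base a.proj)) a.proj)) := rfl
    rw [h3, h4]
    linarith
  refine ⟨w, hw, fun w' hw' => ?_⟩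
  · have key : ∀ z : A.Prolongation a, ∃ Z : A.ProjectableSection, Z.val a = z := by
      rintro ⟨⟨b, v⟩, hz⟩
      obtain ⟨σ, X, hσ, hX, hp⟩ := A.exists_projectable a b v (A.mem_prolongation.1 hz)
      exact ⟨⟨σ, X, fun p => A.mem_prolongation.2 (hp p)⟩, Subtype.ext (Prod.ext hσ hX)⟩
    refine LinearMap.ext₂ fun z z' => ?_
    obtain ⟨Z, rfl⟩ := key z
    obtain ⟨W, rfl⟩ := key z'
    rw [hw', hw]

/-- The Cartan 2-form `ω_L = -dθ_L`. -/
def cartanTwoForm (a : TotalSpace F E) : A.Prolongation a →ₗ[ℝ] A.Prolongation a →ₗ[ℝ] ℝ :=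
  (A.existsUnique_cartanTwoForm L a).choose

lemma mvfderiv_hat_verticalVector (μ : DualSection I F E) (a : TotalSpace F E) (b : E a.proj) :
    mvfderiv (I.prod 𝓘(ℝ, F)) μ.hat a (verticalVector I a b) = μ.toFun a.proj b := by
  have h := mfderiv_verticalVector (I := I) (I' := 𝓘(ℝ, ℝ)) μ.hat a b
    (μ.hat.contMDiff.mdifferentiable (by simp) a)
  refine Eq.trans h ?_
  have h1 : HasDerivAt (fun t : ℝ => μ.hat (⟨a.proj, a.snd + t • b⟩ : TotalSpace F E))
      (μ.toFun a.proj b) 0 := by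
    have h2 : (fun t : ℝ => μ.hat (⟨a.proj, a.snd + t • b⟩ : TotalSpace F E)) =
        fun t => μ.toFun a.proj a.snd + t * μ.toFun a.proj b := by
      funext t
      change μ.toFun a.proj (a.snd + t • b) = _
      rw [map_add, map_smul, smul_eq_mul]
    rw [h2]
    simpa using ((hasDerivAt_id (0 : ℝ)).mul_const (μ.toFun a.proj b)).const_add
      (μ.toFun a.proj a.snd)
  rw [mfderiv_eq_fderiv]
  exact (fderiv_apply_one_eq_deriv (𝕜 := ℝ) (F := ℝ)).trans h1.deriv

lemma dualLieDeriv_eq (σ : Cₛ^∞⟮I; F, E⟯) (μ : DualSection I F E) (η : Cₛ^∞⟮I; F, E⟯) (x : M) :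
    A.dualLieDeriv σ μ η x = mvfderiv I (μ.pair η) x (A.anchor x (σ x)) -
      μ.toFun x (A.bracket σ η x) := by
  change A.sectionDeriv σ (μ.pair η) x - A.sectionDeriv η (μ.pair σ) x -
    μ.toFun x (A.bracket σ η x) + A.sectionDeriv η (μ.pair σ) x = _
  rw [A.sectionDeriv_apply]
  ring

lemma dualLieDeriv_congr (σ : Cₛ^∞⟮I; F, E⟯) (μ : DualSection I F E) {η ζ : Cₛ^∞⟮I; F, E⟯} {x : M}
    (h : η x = ζ x) : A.dualLieDeriv σ μ η x = A.dualLieDeriv σ μ ζ x := by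
  have h1 := A.mvfderiv_pairing_of_apply_eq_zero (I' := I) (id : M → M) x mdifferentiableAt_id
    μ.toFun (fun η => (μ.pair η).contMDiff.mdifferentiable (by simp) x) σ (η - ζ)
    (by simp [h]) (A.anchor x (σ x)) (by rw [mfderiv_id]; rfl)
  have h2 : mvfderiv I (μ.pair η - μ.pair ζ) x (A.anchor x (σ x)) =
      mvfderiv I (μ.pair η) x (A.anchor x (σ x)) - mvfderiv I (μ.pair ζ) x (A.anchor x (σ x)) :=
    congrArg (fun T : TangentSpace I x →L[ℝ] ℝ => T (A.anchor x (σ x)))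
      (mvfderiv_sub ((μ.pair η).contMDiff.mdifferentiable (by simp) x)
        ((μ.pair ζ).contMDiff.mdifferentiable (by simp) x))
  have h3 : (fun y => μ.toFun y ((η - ζ) y)) = (μ.pair η - μ.pair ζ : M → ℝ) := by
    funext y
    exact map_sub (μ.toFun y) _ _
  have h4 : mvfderiv I (μ.pair η - μ.pair ζ : M → ℝ) x (A.anchor x (σ x)) =
      μ.toFun x (A.bracket σ (η - ζ) x) := by
    rw [← h3]
    exact h1
  rw [map_sub] at h4
  have h5 := h4.trans (map_sub (μ.toFun x) _ _)
  have h6 := h2.symm.trans h5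
  rw [A.dualLieDeriv_eq, A.dualLieDeriv_eq]
  linarith

/-- There is exactly one element `z` of the prolongation at `a` that projects to `σ(τ(a))` and
satisfies `d_z μ̂ = (d_σ μ)^(a)` for all sections `μ` of `E*`. -/
theorem existsUnique_completeLift (σ : Cₛ^∞⟮I; F, E⟯) (a : TotalSpace F E) :
    ∃! z : A.Prolongation a, z.1.1 = σ a.proj ∧
      ∀ (μ : DualSection I F E) (η : Cₛ^∞⟮I; F, E⟯), η a.proj = a.snd →
        A.diff μ.hat a z = A.dualLieDeriv σ μ η a.proj := by
  obtain ⟨m, b⟩ := a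
  obtain ⟨η, rfl⟩ := exists_section_through I F m b
  let g : M → TotalSpace F E := fun y => ⟨y, η y⟩
  have hg : MDifferentiableAt I (I.prod 𝓘(ℝ, F)) g m := η.mdifferentiableAt
  let v : TangentSpace (I.prod 𝓘(ℝ, F)) (g m) := mfderiv I (I.prod 𝓘(ℝ, F)) g m (A.anchor m (σ m)) -
    verticalVector I (g m) (A.bracket σ η m)
  have hv : A.anchor m (σ m) = mfderiv (I.prod 𝓘(ℝ, F)) I (π F E) (g m) v := by
    have h1 := mfderiv_comp (I := I) (I' := I.prod 𝓘(ℝ, F)) (I'' := I) m (g := π F E) (f := g)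
      ((contMDiff_proj E (n := 1)).mdifferentiableAt (by simp)) hg
    have h2 : (π F E) ∘ g = id := rfl
    rw [h2, mfderiv_id] at h1
    have h3 := congrArg (fun T : TangentSpace I m →L[ℝ] TangentSpace I m => T (A.anchor m (σ m))) h1
    rw [map_sub, mfderiv_proj_verticalVector, sub_zero]
    exact h3
  have hμ : ∀ μ : DualSection I F E, mvfderiv (I.prod 𝓘(ℝ, F)) μ.hat (g m) v =
      A.dualLieDeriv σ μ η m := by
    intro μ
    rw [A.dualLieDeriv_eq, map_sub, mvfderiv_hat_verticalVector]
    congr 1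
    exact (mvfderiv_comp_apply (g := μ.hat) (f := g) m
      (μ.hat.contMDiff.mdifferentiable (by simp) _) hg (A.anchor m (σ m))).symm
  refine ⟨⟨(σ m, v), A.mem_prolongation.2 hv⟩, ⟨rfl, fun μ ζ hζ => ?_⟩, ?_⟩
  · exact (hμ μ).trans (A.dualLieDeriv_congr σ μ (show η m = ζ m from hζ.symm))
  · rintro ⟨⟨b, u⟩, hz⟩ ⟨hb, hu⟩
    obtain rfl : b = σ m := hb
    refine Subtype.ext (Prod.ext rfl ?_)
    refine tangent_totalSpace_ext ((A.mem_prolongation.1 hz).symm.trans hv) fun μ hs => ?_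
    exact (hu ⟨μ, hs⟩ η rfl).trans (hμ ⟨μ, hs⟩).symm

/-- The complete lift `σ^C` of a section `σ` of `E`. -/
def completeLift (σ : Cₛ^∞⟮I; F, E⟯) (a : TotalSpace F E) : A.Prolongation a :=
  (A.existsUnique_completeLift σ a).choose

end LieAlgebroid

variable (I F E) in
/-- A smooth vector subbundle `D` of `E`: a family of subspaces that is locally spanned by
pointwise linearly independent smooth sections. -/
structure SmoothSubbundle where
  fiber : ∀ x : M, Submodule ℝ (E x)
  exists_frame : ∀ x : M, ∃ U : Set M, IsOpen U ∧ x ∈ U ∧ ∃ (k : ℕ) (s : Fin k → ∀ y, E y),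
    (∀ i, ContMDiffOn I (I.prod 𝓘(ℝ, F)) ∞ (fun y => TotalSpace.mk' F y (s i y)) U) ∧
    ∀ y ∈ U, LinearIndependent ℝ (fun i => s i y) ∧
      Submodule.span ℝ (Set.range fun i => s i y) = fiber y

namespace SmoothSubbundle
variable (D : SmoothSubbundle I F E)

/-- The total space of the subbundle as a subset of the total space of `E`. -/
def total : Set (TotalSpace F E) := {a | a.snd ∈ D.fiber a.proj}

/-- The tangent space `T_a D ⊆ T_a E`: the velocities of smooth curves in `D` through `a`. -/
def tangentSet (a : TotalSpace F E) : Set (TangentSpace (I.prod 𝓘(ℝ, F)) a) :=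
  {v | ∃ γ : ℝ → TotalSpace F E, ContMDiffAt 𝓘(ℝ, ℝ) (I.prod 𝓘(ℝ, F)) ∞ γ 0 ∧
    (∀ᶠ t in 𝓝 0, γ t ∈ D.total) ∧
    tangentMap 𝓘(ℝ, ℝ) (I.prod 𝓘(ℝ, F)) γ ⟨0, (1 : ℝ)⟩ = ⟨a, v⟩}

end SmoothSubbundle

namespace LieAlgebroid
variable (A : LieAlgebroid I F E) (L : C^∞⟮I.prod 𝓘(ℝ, F), TotalSpace F E; ℝ⟯)
  (D : SmoothSubbundle I F E)

/-- The fibre at `a` of the `D`-tangent bundle of `D`, inside the prolongation of `E`. -/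
def prolongationOf (a : TotalSpace F E) : Set (A.Prolongation a) :=
  {z | z.1.1 ∈ D.fiber a.proj ∧ z.1.2 ∈ D.tangentSet a}

/-- The pullback to the prolongation, at `a`, of the annihilator of `D`. -/
def annihilatorPullback (a : TotalSpace F E) : Set (A.Prolongation a →ₗ[ℝ] ℝ) :=
  {α | ∃ l : E a.proj →ₗ[ℝ] ℝ, (∀ d ∈ D.fiber a.proj, l d = 0) ∧
    ∀ z : A.Prolongation a, α z = l z.1.1}

/-- `Γ` is a solution of the constrained Lagrangian system `(L, D)`: a smooth SODE section on `D`
with values in the `D`-tangent bundle of `D` that satisfies the Lagrange-d'Alembert equations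
along `D`. Only the values of `Γ` on `D` matter. -/
structure IsSolution (Γ : ∀ a : TotalSpace F E, A.Prolongation a) : Prop where
  contMDiffOn : ContMDiffOn (I.prod 𝓘(ℝ, F)) (I.prod 𝓘(ℝ, F)).tangent ∞
    (fun a => (⟨a, (Γ a).1.2⟩ : TangentBundle (I.prod 𝓘(ℝ, F)) (TotalSpace F E))) D.total
  sode : ∀ a ∈ D.total, A.verticalEndo a (Γ a) = A.liouville a
  tangent : ∀ a ∈ D.total, Γ a ∈ A.prolongationOf D a
  lagrange_dAlembert : ∀ a ∈ D.total,
    A.cartanTwoForm L a (Γ a) - A.diff (A.energy L) a ∈ A.annihilatorPullback D a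

/-- The function `ḟ` on `E` associated to a function `f` on `M`: `ḟ(a) = df(a) = ρ(a)f`. -/
def timeDeriv (f : C^∞⟮I, M; ℝ⟯) (a : TotalSpace F E) : ℝ :=
  mvfderiv I f a.proj (A.anchor a.proj a.snd)

end LieAlgebroid
end Prolongation

end AlgebroidMechanics

end

/-! Everything reduces to one pointwise identity. If `z` in the prolongation at `a` satisfies `S z =
Δ(a)`, then for every section `σ` ω_L(z, σ^C) - d_{σ^C} E_L = d_{σ^C} L - d_z ⟨θ_L, σ^C⟩, which is
`cartanTwoForm_completeLift_sub_energy`. Apply it to `z = Γ(a)` with `a ∈ D`. By Lagrange-d'Alembert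
the left side is `⟨λ, σ(τ(a))⟩`, which vanishes because `σ` takes values in `D` and `λ` annihilates
`D`. Hence `d_Γ ⟨θ_L, σ^C⟩ = d_{σ^C} L = ḟ(a)`. The SODE condition says that the first component of
`Γ(a)` is `a`, so `d_Γ (f ∘ τ) = ρ(a) f = ḟ(a)` too, and the difference `F` has derivative zero.

For the identity, write `σ^V L` for the derivative of `L` along the vertical lift of `σ`
(`fiberDeriv`); it is the smooth function `⟨θ_L, σ^C⟩`. Choose any section `η` with `η(τ(a)) = a`.
Two formulas are combined: ω_L(z, σ^C) = d_{σ^C}(η^V L) - d_z(σ^V L) + [η, σ]^V L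
(`cartanTwoForm_apply`), d_{σ^C}(d_Δ L) = d_{σ^C}(η^V L) - [σ, η]^V L
(`diff_diff_liouville_completeLift`). Since `E_L = d_Δ L - L`, subtraction cancels the terms with
`η` and the terms with the bracket, and the identity remains.

The second formula is where the complete lift matters. In a local frame `s_i` with dual frame `μ_i`,
one has `d_Δ L = ∑ μ̂_i (s_i^V L)` and `η^V L = ∑ ⟨μ_i, η⟩ (s_i^V L)`. The coefficients agree at
`a`, and their derivatives along `σ^C` differ by `-⟨μ_i, [σ, η]⟩`, by the defining property of
`σ^C`. -/

namespace AlgebroidMechanics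

set_option linter.unusedSectionVars false

section Noether

variable {V : Type*} [NormedAddCommGroup V] [NormedSpace ℝ V] [FiniteDimensional ℝ V]
  {H : Type*} [TopologicalSpace H] {I : ModelWithCorners ℝ V H} [I.Boundaryless]
  {M : Type*} [TopologicalSpace M] [ChartedSpace H M] [IsManifold I ∞ M] [T2Space M]
  {F : Type*} [NormedAddCommGroup F] [NormedSpace ℝ F] [FiniteDimensional ℝ F]
  {E : M → Type*} [TopologicalSpace (TotalSpace F E)]
  [∀ x, AddCommGroup (E x)] [∀ x, Module ℝ (E x)] [∀ x, TopologicalSpace (E x)]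
  [FiberBundle F E] [VectorBundle ℝ F E] [ContMDiffVectorBundle ∞ F E I]

/-! ### Global frames and dual frames obtained by cutting off local ones. -/

/-- A linear functional on the model fibre extends, in a local trivialization and near a point, to
a smooth global section of the dual bundle. -/
lemma exists_dualSection_eventuallyEq (m : M) (l : F →L[ℝ] ℝ) :
    ∃ μ : DualSection I F E, ∀ᶠ y in 𝓝 m, ∀ b : E y,
      μ.toFun y b = l (trivializationAt F E m ⟨y, b⟩).2 := by
  set e := trivializationAt F E m
  have hm : m ∈ e.baseSet := FiberBundle.mem_baseSet_trivializationAt' _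
  obtain ⟨χ, hχ1, hχ2⟩ := exists_bump I (e.open_baseSet.mem_nhds hm)
  -- The bump function makes the local functional global. Off the base set `linearMapAt` has the
  -- default value zero; smoothness there comes from `χ` vanishing near the point, its closed
  -- support being inside the base set.
  let μ : ∀ x : M, E x →ₗ[ℝ] ℝ := fun x => χ x • l.toLinearMap.comp (e.linearMapAt ℝ x)
  have hμ : ∀ p : TotalSpace F E, p.proj ∈ e.baseSet → μ p.proj p.snd = χ p.proj * l (e p).2 := by
    intro p hp
    simp [μ, hp]
  refine ⟨⟨μ, fun p => ?_⟩, ?_⟩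
  · by_cases hp : p.proj ∈ e.baseSet
    · have g1 : ContMDiffAt (I.prod 𝓘(ℝ, F)) 𝓘(ℝ, F) ∞ (fun q : TotalSpace F E => (e q).2) p :=
        ((e.contMDiffAt_iff (f := id) (x₀ := p) (e.mem_source.2 hp)).1 contMDiffAt_id).2
      have g2 : ContMDiffAt (I.prod 𝓘(ℝ, F)) 𝓘(ℝ, ℝ) ∞ (fun q : TotalSpace F E => χ q.proj) p :=
        (χ.contMDiff.comp (contMDiff_proj E)).contMDiffAt
      have g3 : ContMDiffAt (I.prod 𝓘(ℝ, F)) 𝓘(ℝ, ℝ) ∞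
          (fun q : TotalSpace F E => l (e q).2) p :=
        ContMDiffAt.comp (I' := 𝓘(ℝ, F)) (g := l) (f := fun q : TotalSpace F E => (e q).2) p
          l.contMDiff.contMDiffAt g1
      refine (g2.mul g3).congr_of_eventuallyEq ?_
      filter_upwards [(e.open_baseSet.preimage (FiberBundle.continuous_proj F E)).mem_nhds hp]
        with q hq using hμ q hq
    · have h3 : χ =ᶠ[𝓝 p.proj] 0 := notMem_tsupport_iff_eventuallyEq.1 fun h => hp (hχ1 h)
      refine (contMDiffAt_const (c := (0 : ℝ))).congr_of_eventuallyEq ?_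
      filter_upwards [(FiberBundle.continuous_proj F E).continuousAt.eventually h3] with z hz
      simp [μ, hz]
  · filter_upwards [hχ2, e.open_baseSet.mem_nhds hm] with y hy1 hy2 b
    exact (hμ ⟨y, b⟩ hy2).trans (by rw [show χ (⟨y, b⟩ : TotalSpace F E).proj = 1 from hy1, one_mul])

variable (I F E) in
/-- Near every point the bundle has a frame consisting of global sections, with a dual frame
consisting of global sections of the dual bundle. -/
lemma exists_frame_dualFrame (m : M) :
    ∃ (k : ℕ) (μ : Fin k → DualSection I F E) (s : Fin k → Cₛ^∞⟮I; F, E⟯),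
      ∀ᶠ y in 𝓝 m, ∀ b : E y, b = ∑ i, (μ i).toFun y b • s i y := by
  set e := trivializationAt F E m with he
  have hm : m ∈ e.baseSet := FiberBundle.mem_baseSet_trivializationAt' m
  set β := Module.finBasis ℝ F
  -- The functionals are the coordinates of the same basis `β` that gives the frame `s`, so each `μ
  -- i` reads off the coefficient of `s i`.
  choose μ hμ using fun i => exists_dualSection_eventuallyEq (I := I) (E := E) m
    (LinearMap.toContinuousLinearMap (β.coord i))
  choose s hs using fun i => exists_section_eventuallyEq I e.open_baseSet hm _
    (contMDiffOn_symm_const I F e (fun _ => β i) contMDiffOn_const)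
  refine ⟨_, μ, s, ?_⟩
  filter_upwards [eventually_all.2 hμ, eventually_all.2 hs, e.open_baseSet.mem_nhds hm]
    with y h1 h2 hy b
  have h3 : (e ⟨y, b⟩).2 = ∑ i, β.repr (e ⟨y, b⟩).2 i • β i := (β.sum_repr _).symm
  have h4 : b = e.symm y (e ⟨y, b⟩).2 := (e.symm_apply_apply_mk hy _).symm
  rw [← e.symmL_apply (R := ℝ) hy] at h4
  -- Only the left side is expanded, since `b` also occurs in the coefficients on the right.
  conv_lhs => rw [h4, h3]
  rw [map_sum]
  refine Finset.sum_congr rfl fun i _ => ?_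
  rw [map_smul, e.symmL_apply hy, h1, h2]
  rfl

/-! ### Vertical lifts, complete lifts and the Cartan 1-form. -/

namespace LieAlgebroid
variable (A : LieAlgebroid I F E) (L : C^∞⟮I.prod 𝓘(ℝ, F), TotalSpace F E; ℝ⟯)

/-- The vertical vector `b_a^V` differentiates `μ̂` to `⟨μ, b⟩`. If it vanishes, then all
coordinates of `b` in a dual frame vanish. Injectivity is what turns the SODE condition `S z = Δ(a)`
into an equation between elements of `E`. -/
lemma verticalLift_injective (a : TotalSpace F E) : Function.Injective (A.verticalLift a) := by
  rw [injective_iff_map_eq_zero]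
  intro b hb
  have hv : verticalVector I a b = 0 := congrArg (fun z : A.Prolongation a => z.1.2) hb
  obtain ⟨k, μ, s, h⟩ := exists_frame_dualFrame I F E a.proj
  rw [h.self_of_nhds b]
  refine Finset.sum_eq_zero fun i _ => ?_
  rw [← mvfderiv_hat_verticalVector (μ i) a b, hv, map_zero, zero_smul]

/-- A vector `z` with `S z = Δ(a)` has first component `a`. -/
lemma fst_eq_of_verticalEndo_eq_liouville {a : TotalSpace F E} {z : A.Prolongation a}
    (h : A.verticalEndo a z = A.liouville a) : z.1.1 = a.snd :=
  A.verticalLift_injective a h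

lemma completeLift_fst (σ : Cₛ^∞⟮I; F, E⟯) (a : TotalSpace F E) :
    (A.completeLift σ a).1.1 = σ a.proj :=
  (A.existsUnique_completeLift σ a).choose_spec.1.1

/-- The defining property of `σ^C` in explicit form: in the Cartan formula for `d_σ μ` the two terms
`ρ(η)⟨μ, σ⟩` cancel. Together with the first component, this is all that the proof needs to know
about complete lifts. -/
lemma diff_hat_completeLift (σ : Cₛ^∞⟮I; F, E⟯) (a : TotalSpace F E) (μ : DualSection I F E)
    {η : Cₛ^∞⟮I; F, E⟯} (hη : η a.proj = a.snd) :
    A.diff μ.hat a (A.completeLift σ a) =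
      mvfderiv I (μ.pair η) a.proj (A.anchor a.proj (σ a.proj)) -
        μ.toFun a.proj (A.bracket σ η a.proj) :=
  ((A.existsUnique_completeLift σ a).choose_spec.1.2 μ η hη).trans (A.dualLieDeriv_eq σ μ η a.proj)

/-- The form `θ_L = dL ∘ S` sees only the first component of its argument, and that of `σ^C` is `σ`.
The right side is a bundled smooth function, which gives the smoothness of the Noether function. -/
lemma cartanOneForm_completeLift (σ : Cₛ^∞⟮I; F, E⟯) :
    (fun a => A.cartanOneForm L a (A.completeLift σ a)) = fiberDeriv L σ := by
  funext a
  change A.verticalDeriv L a (A.completeLift σ a).1.1 = _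
  rw [completeLift_fst]
  rfl

/-! ### Differentiation rules for functions on `E` along the prolongation. -/

/-- The differential of a function pulled back from the base. -/
lemma diff_comp_proj (f : C^∞⟮I, M; ℝ⟯) (a : TotalSpace F E) (z : A.Prolongation a) :
    A.diff (fun p => f p.proj) a z = mvfderiv I f a.proj (A.anchor a.proj z.1.1) := by
  rw [A.mem_prolongation.1 z.2]
  exact mvfderiv_comp_apply (g := f) (f := π F E) a (f.contMDiff.mdifferentiable (by simp) _)
    ((contMDiff_proj E (n := 1)).mdifferentiableAt (by simp)) z.1.2

lemma diff_sub {g h : TotalSpace F E → ℝ} {a : TotalSpace F E}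
    (hg : MDifferentiableAt (I.prod 𝓘(ℝ, F)) 𝓘(ℝ, ℝ) g a)
    (hh : MDifferentiableAt (I.prod 𝓘(ℝ, F)) 𝓘(ℝ, ℝ) h a) (z : A.Prolongation a) :
    A.diff (fun p => g p - h p) a z = A.diff g a z - A.diff h a z :=
  congrArg (fun T : TangentSpace (I.prod 𝓘(ℝ, F)) a →L[ℝ] ℝ => T z.1.2) (mvfderiv_sub hg hh)

lemma diff_congr {g h : TotalSpace F E → ℝ} {a : TotalSpace F E} (hgh : g =ᶠ[𝓝 a] h) :
    A.diff g a = A.diff h a := by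
  ext z
  exact congrArg (fun T : V × F →L[ℝ] ℝ => T z.1.2)
    (hgh.mfderiv_eq (I := I.prod 𝓘(ℝ, F)) (I' := 𝓘(ℝ, ℝ)))

lemma diff_sum_mul {k : ℕ} {g h : Fin k → TotalSpace F E → ℝ} {a : TotalSpace F E}
    (hg : ∀ i, MDifferentiableAt (I.prod 𝓘(ℝ, F)) 𝓘(ℝ, ℝ) (g i) a)
    (hh : ∀ i, MDifferentiableAt (I.prod 𝓘(ℝ, F)) 𝓘(ℝ, ℝ) (h i) a) (z : A.Prolongation a) :
    A.diff (fun p => ∑ i, g i p * h i p) a z =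
      ∑ i, (g i a * A.diff (h i) a z + h i a * A.diff (g i) a z) := by
  change mvfderiv (I.prod 𝓘(ℝ, F)) (fun p => ∑ i, g i p * h i p) a z.1.2 = _
  rw [mvfderiv_sum (g := fun i p => g i p * h i p) Finset.univ fun i _ => (hg i).mul (hh i)]
  simp only [sum_apply]
  refine Finset.sum_congr rfl fun i _ => ?_
  rw [mvfderiv_fun_mul (hg i) (hh i)]
  rfl

/-! ### The function `d_Δ L` and its derivative along a complete lift. -/

/-- The derivative `d_Δ L` in terms of a frame and its dual frame. -/
lemma diff_liouville_eventuallyEq {a : TotalSpace F E} {k : ℕ} {μ : Fin k → DualSection I F E}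
    {s : Fin k → Cₛ^∞⟮I; F, E⟯}
    (h : ∀ᶠ y in 𝓝 a.proj, ∀ b : E y, b = ∑ i, (μ i).toFun y b • s i y) :
    (fun p => A.diff L p (A.liouville p)) =ᶠ[𝓝 a]
      fun p => ∑ i, (μ i).hat p * fiberDeriv L (s i) p := by
  filter_upwards [(FiberBundle.continuous_proj F E).continuousAt.eventually h] with p hp
  -- At `p` the Liouville section is the vertical lift of `p` itself, and the vertical derivative is
  -- linear in the lifted vector, so `p.snd` can be expanded in the frame.
  change A.verticalDeriv L p p.snd = _
  conv_lhs => rw [hp p.snd]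
  rw [map_sum]
  refine Finset.sum_congr rfl fun i _ => ?_
  rw [map_smul]
  rfl

/-- The function `d_Δ L` is differentiable. -/
lemma mdifferentiableAt_diff_liouville (a : TotalSpace F E) :
    MDifferentiableAt (I.prod 𝓘(ℝ, F)) 𝓘(ℝ, ℝ) (fun p => A.diff L p (A.liouville p)) a := by
  obtain ⟨k, μ, s, h⟩ := exists_frame_dualFrame I F E a.proj
  -- The function `d_Δ L` is defined pointwise; its regularity is read off from the local formula,
  -- whose factors are bundled smooth functions.
  have hs : ContMDiffAt (I.prod 𝓘(ℝ, F)) 𝓘(ℝ, ℝ) ∞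
      (fun p => ∑ i, (μ i).hat p * fiberDeriv L (s i) p) a :=
    ContMDiffAt.sum fun i _ =>
      (μ i).hat.contMDiff.contMDiffAt.mul (fiberDeriv L (s i)).contMDiff.contMDiffAt
  exact (hs.congr_of_eventuallyEq (A.diff_liouville_eventuallyEq L h)).mdifferentiableAt (by simp)

/-- The derivative of `d_Δ L` along a complete lift, compared with the derivative of `d_{η^V} L`
for a section `η` through the given point. -/
lemma diff_diff_liouville_completeLift (σ η : Cₛ^∞⟮I; F, E⟯) (a : TotalSpace F E)
    (hη : η a.proj = a.snd) :
    A.diff (fun p => A.diff L p (A.liouville p)) a (A.completeLift σ a) =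
      A.diff (fiberDeriv L η) a (A.completeLift σ a) -
        A.verticalDeriv L a (A.bracket σ η a.proj) := by
  obtain ⟨k, μ, s, h⟩ := exists_frame_dualFrame I F E a.proj
  -- The same expansion as for `d_Δ L`, over the same functions `s_i^V L`, but with the basic
  -- coefficients `⟨μ_i, η⟩ ∘ τ` in place of the linear functions `μ̂_i`.
  have h1 : (fiberDeriv L η : TotalSpace F E → ℝ) =ᶠ[𝓝 a]
      fun p => ∑ i, (μ i).pair η p.proj * fiberDeriv L (s i) p := by
    filter_upwards [(FiberBundle.continuous_proj F E).continuousAt.eventually h] with p hp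
    change A.verticalDeriv L p (η p.proj) = _
    conv_lhs => rw [hp (η p.proj)]
    rw [map_sum]
    refine Finset.sum_congr rfl fun i _ => ?_
    rw [map_smul]
    rfl
  -- The bracket is expanded in the same frame, so that the claim can be checked summand by summand.
  have h2 : A.verticalDeriv L a (A.bracket σ η a.proj) =
      ∑ i, (μ i).toFun a.proj (A.bracket σ η a.proj) * fiberDeriv L (s i) a := by
    conv_lhs => rw [h.self_of_nhds (A.bracket σ η a.proj)]
    rw [map_sum]
    refine Finset.sum_congr rfl fun i _ => ?_
    rw [map_smul]
    rfl
  have hd : ∀ i, MDifferentiableAt (I.prod 𝓘(ℝ, F)) 𝓘(ℝ, ℝ) (fiberDeriv L (s i)) a :=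
    fun i => mdifferentiableAt_fiberDeriv L (s i) a
  have hp : ∀ i, MDifferentiableAt (I.prod 𝓘(ℝ, F)) 𝓘(ℝ, ℝ)
      (fun p : TotalSpace F E => (μ i).pair η p.proj) a := fun i =>
    (((μ i).pair η).contMDiff.comp (contMDiff_proj E)).mdifferentiable (by simp) a
  rw [A.diff_congr (A.diff_liouville_eventuallyEq L h), A.diff_congr h1, h2,
    A.diff_sum_mul (fun i => (μ i).hat.contMDiff.mdifferentiable (by simp) a) hd,
    A.diff_sum_mul hp hd, ← Finset.sum_sub_distrib]
  refine Finset.sum_congr rfl fun i _ => ?_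
  -- The coefficients agree at `a` because `η` passes through `a`. The terms that differentiate
  -- `s_i^V L` therefore cancel, and only the derivatives of the coefficients are left to compare.
  have h3 : (μ i).pair η a.proj = (μ i).hat a := congrArg ((μ i).toFun a.proj) hη
  rw [A.diff_hat_completeLift σ a (μ i) hη, A.diff_comp_proj, A.completeLift_fst, h3]
  ring

/-! ### The Cartan 2-form on arbitrary vectors and its contraction with a complete lift. -/

/-- The form `ω_L` is characterized by its values on projectable sections, so arbitrary vectors have
to be extended before it can be evaluated. -/
lemma exists_projectableSection_val_eq (a : TotalSpace F E) (z : A.Prolongation a) :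
    ∃ Z : A.ProjectableSection, Z.val a = z := by
  obtain ⟨⟨b, v⟩, hz⟩ := z
  obtain ⟨σ, X, hσ, hX, hp⟩ := A.exists_projectable a b v (A.mem_prolongation.1 hz)
  exact ⟨⟨σ, X, fun p => A.mem_prolongation.2 (hp p)⟩, Subtype.ext (Prod.ext hσ hX)⟩

/-- The Cartan 2-form on `z`, `w` in terms of sections through their first components. -/
lemma cartanTwoForm_apply {a : TotalSpace F E} (z w : A.Prolongation a) {η σ : Cₛ^∞⟮I; F, E⟯}
    (hη : η a.proj = z.1.1) (hσ : σ a.proj = w.1.1) :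
    A.cartanTwoForm L a z w = A.diff (fiberDeriv L η) a w - A.diff (fiberDeriv L σ) a z +
      A.verticalDeriv L a (A.bracket η σ a.proj) := by
  obtain ⟨Z, rfl⟩ := A.exists_projectableSection_val_eq a z
  obtain ⟨W, rfl⟩ := A.exists_projectableSection_val_eq a w
  have h0 : A.cartanTwoForm L a (Z.val a) (W.val a) = -A.extDeriv (A.cartanOneForm L) Z W a :=
    (A.existsUnique_cartanTwoForm L a).choose_spec.1 Z W
  -- The base sections are exchanged one at a time: first `W.base` for `σ`, then, in `h2`, `Z.base`
  -- for `η`. The bracket moves along `[Z.base, W.base]`, `[Z.base, σ]`, `[η, σ]`, and each exchange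
  -- alters a derivative term and the bracket term by amounts that cancel in `ω_L`.
  have h1 := A.fiberHessian_sub L a Z.base W.base σ hσ.symm (Z.field a)
    (A.mem_prolongation.1 (Z.mem a)).symm
  have h2 := A.fiberHessian_sub L a σ Z.base η hη.symm (W.field a)
    (by rw [hσ]; exact (A.mem_prolongation.1 (W.mem a)).symm)
  rw [A.bracket_antisymm σ Z.base, A.bracket_antisymm σ η] at h2
  simp only [ContMDiffSection.coe_neg, Pi.neg_apply, map_neg] at h2
  have h3 : A.extDeriv (A.cartanOneForm L) Z W a = fiberHessian L a W.base (Z.field a) -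
    fiberHessian L a Z.base (W.field a) -
      A.verticalDeriv L a (A.bracket Z.base W.base a.proj) := rfl
  have h4 : A.diff (fiberDeriv L η) a (W.val a) = fiberHessian L a η (W.field a) := rfl
  have h5 : A.diff (fiberDeriv L σ) a (Z.val a) = fiberHessian L a σ (Z.field a) := rfl
  rw [h0, h3, h4, h5]
  linarith

/-- For `z` with `S z = Δ(a)`, contraction of the Cartan 2-form with a complete lift. -/
lemma cartanTwoForm_completeLift_sub_energy {a : TotalSpace F E} {z : A.Prolongation a}
    (hz : A.verticalEndo a z = A.liouville a) (σ : Cₛ^∞⟮I; F, E⟯) :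
    A.cartanTwoForm L a z (A.completeLift σ a) - A.diff (A.energy L) a (A.completeLift σ a) =
      A.diff L a (A.completeLift σ a) - A.diff (fiberDeriv L σ) a z := by
  have hz1 := A.fst_eq_of_verticalEndo_eq_liouville hz
  -- By the SODE condition `a` is also the first component of `z`. Hence one section `η` serves both
  -- in the formula for `ω_L` and in the derivative of `d_Δ L`.
  obtain ⟨η, hη⟩ := exists_section_through I F a.proj a.snd
  have h1 := A.cartanTwoForm_apply L z (A.completeLift σ a) (hη.trans hz1.symm)
    (A.completeLift_fst σ a).symm
  have h2 : A.diff (A.energy L) a (A.completeLift σ a) = _ :=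
    A.diff_sub (A.mdifferentiableAt_diff_liouville L a) (L.contMDiff.mdifferentiable (by simp) a)
      (A.completeLift σ a)
  -- Antisymmetry rewrites the bracket as `[η, σ]`, the order in which it occurs in `h1`, so that it
  -- drops out of the difference.
  rw [A.diff_diff_liouville_completeLift L σ η a hη, A.bracket_antisymm σ η] at h2
  simp only [ContMDiffSection.coe_neg, Pi.neg_apply, map_neg] at h2
  rw [h1, h2]
  ring

end LieAlgebroid
end Noether

end AlgebroidMechanics

/-! ### Noether's theorem. -/

theorem mainTheorem10
    {V : Type*} [NormedAddCommGroup V] [NormedSpace ℝ V] [FiniteDimensional ℝ V]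
    {H : Type*} [TopologicalSpace H] {I : ModelWithCorners ℝ V H} [I.Boundaryless]
    {M : Type*} [TopologicalSpace M] [ChartedSpace H M] [IsManifold I ∞ M]
    [T2Space M] [SecondCountableTopology M]
    {F : Type*} [NormedAddCommGroup F] [NormedSpace ℝ F] [FiniteDimensional ℝ F]
    {E : M → Type*} [TopologicalSpace (TotalSpace F E)]
    [∀ x, AddCommGroup (E x)] [∀ x, Module ℝ (E x)] [∀ x, TopologicalSpace (E x)]
    [FiberBundle F E] [VectorBundle ℝ F E] [ContMDiffVectorBundle ∞ F E I]
    (A : AlgebroidMechanics.LieAlgebroid I F E)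
    (L : C^∞⟮I.prod 𝓘(ℝ, F), TotalSpace F E; ℝ⟯)
    (D : AlgebroidMechanics.SmoothSubbundle I F E)
    (Γ : ∀ a : TotalSpace F E, A.Prolongation a)
    (hΓ : A.IsSolution L D Γ)
    (hunique : ∀ Γ' : (∀ a : TotalSpace F E, A.Prolongation a), A.IsSolution L D Γ' →
      ∀ a ∈ D.total, Γ' a = Γ a)
    (σ : Cₛ^∞⟮I; F, E⟯) (hσ : ∀ x, σ x ∈ D.fiber x)
    (f : C^∞⟮I, M; ℝ⟯)
    (hf : ∀ a ∈ D.total, A.diff L a (A.completeLift σ a) = A.timeDeriv f a) :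
    ContMDiff (I.prod 𝓘(ℝ, F)) 𝓘(ℝ, ℝ) ∞
      (fun a : TotalSpace F E => A.cartanOneForm L a (A.completeLift σ a) - f a.proj) ∧
    ∀ a ∈ D.total,
      A.diff (fun a => A.cartanOneForm L a (A.completeLift σ a) - f a.proj) a (Γ a) = 0 := by
  have hF : (fun a : TotalSpace F E => A.cartanOneForm L a (A.completeLift σ a) - f a.proj) =
      fun a => AlgebroidMechanics.fiberDeriv L σ a - f a.proj := by
    rw [← A.cartanOneForm_completeLift L σ]
  have hfs : ContMDiff (I.prod 𝓘(ℝ, F)) 𝓘(ℝ, ℝ) ∞ (fun a : TotalSpace F E => f a.proj) :=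
    f.contMDiff.comp (contMDiff_proj E)
  rw [hF]
  refine ⟨(AlgebroidMechanics.fiberDeriv L σ).contMDiff.sub hfs, fun a ha => ?_⟩
  obtain ⟨l, hl, hlz⟩ := hΓ.lagrange_dAlembert a ha
  have h1 := hlz (A.completeLift σ a)
  -- The Lagrange-d'Alembert equations are tested against every vector of the prolongation, and the
  -- reaction `l` sees only its first component. So it is enough that `σ` lies in `D`; tangency of
  -- `σ^C` to `D` plays no role.
  rw [A.completeLift_fst, hl _ (hσ a.proj), LinearMap.sub_apply,
    A.cartanTwoForm_completeLift_sub_energy L (hΓ.sode a ha), hf a ha] at h1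
  -- The SODE condition enters a second time: the first component of `Γ a` is `a`, so the derivative
  -- of `f ∘ τ` along `Γ` is `ḟ(a)`, the value that `h1` gives for the derivative of `σ^V L`.
  rw [A.diff_sub (AlgebroidMechanics.LieAlgebroid.mdifferentiableAt_fiberDeriv L σ a)
    (hfs.mdifferentiable (by simp) a), A.diff_comp_proj,
    A.fst_eq_of_verticalEndo_eq_liouville (hΓ.sode a ha)]
  exact sub_eq_zero.2 (sub_eq_zero.1 h1).symm
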